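/- Let $T$ be an integral domain and $n\ge 1$. Let $m_j,d_j,d_{jk}\in\mathbb Z_{>0}$ and $m_{jk}\in\mathbb Z$ ($1\le j,k\le n$) satisfy $\gcd(m_j,d_j)=1$, $\gcd(m_{jk},d_{jk})=1$, $d_{jk}=d_{kj}$, $m_{jk}=-m_{kj}$, and assume that $d_j\mid d_l$ and $d_{jk}\mid d_l$ for all $j\le l$ and all $k$. Let $\epsilon\in T^\times$ be a primitive $d_n$-th root of unity, put $\epsilon_j:=\epsilon^{d_nm_j/d_j}$, $\beta_{jk}:=\epsilon^{d_nm_{jk}/d_{jk}}$, and assume $\epsilon_j\neq 1$ for all $j$. Let $A=A_n^{E,B}(T)$ be the quantized Weyl algebra, i.e. the unital associative $T$-algebra with generators $x_1,y_1,\dots,x_n,y_n$ and relations \begin{align*} y_jy_k&=\beta_{jk}y_ky_j \ (\forall j,k), & x_jx_k&=\epsilon_j\beta_{jk}x_kx_j\ (j<k),\\ x_jy_k&=\beta_{kj}y_kx_j\ (j<k), & x_jy_k&=\epsilon_k\beta_{kj}y_kx_j\ (j>k),\\ x_jy_j-\epsilon_jy_jx_j&=1+\sum_{i<j}(\epsilon_i-1)y_ix_i\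 (\forall j), \end{align*} and let $A_q$ be the $T[q^{\pm1}]$-algebra with generators $\widetilde x_j,\widetilde y_j$ and the same relations with $\epsilon_j,\beta_{jk}$ replaced by $q^{d_nm_j/d_j}$, $q^{d_nm_{jk}/d_{jk}}$. The $T$-algebra homomorphism $\sigma\colon A_q\to A$, $\widetilde x_j\mapsto x_j$, $\widetilde y_j\mapsto y_j$, $q\mapsto\epsilon$, is surjective with kernel $(q-\epsilon)A_q$, and it induces a Poisson bracket on the center $\mathcal Z(A)$: $\{z,w\}=\sigma\big((cc'-c'c)/(q-\epsilon)\big)$ for any $c\in\sigma^{-1}(z)$, $c'\in\sigma^{-1}(w)$. Put $z_j:=1+\sum_{i\le j}(\epsilon_i-1)y_ix_i$ and $\widetilde z_j:=1+\sum_{i\le j}(q^{d_nm_i/d_i}-1)\widetilde y_i\widetilde x_i$. The elements $X_j:=x_j^{d_j}$, $Y_j:=y_j^{d_j}$ are central and $\mathcal Z(A)=T[X_j,Y_j,\ 1\le j\le n]$ is a polynomial algebra in them. Define $Z_0:=1$ and $Z_j:=-(1-\epsilon_j)^{d_j}Y_jX_j+Z_{j-1}^{d_j/d_{j-1}}$ for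 $1\le j\le n$ (with $d_0:=1$). Then \[ \sigma(\widetilde z_j)^{d_j}=z_j^{d_j}=Z_j\in\mathcal Z(A)\qquad(1\le j\le n), \] the induced Poisson bracket on $\mathcal Z(A)$ is given by \begin{align*} \{X_j,Y_j\}&=m_jd_jd_n\epsilon^{-1}\big(X_jY_j-(1-\epsilon_j)^{-d_j}Z_{j-1}^{d_j/d_{j-1}}\big), &&\forall j,\\ \{Y_j,Y_k\}&=\tfrac{m_{jk}d_jd_kd_n}{d_{jk}}\epsilon^{-1}Y_jY_k, &&\forall j,k,\\ \{X_j,Y_k\}&=-\tfrac{m_{jk}d_jd_kd_n}{d_{jk}}\epsilon^{-1}X_jY_k, &&j<k,\\ \{X_j,X_k\}&=d_jd_kd_n\big(\tfrac{m_j}{d_j}+\tfrac{m_{jk}}{d_{jk}}\big)\epsilon^{-1}X_jX_k, &&j<k,\\ \{X_j,Y_k\}&=d_jd_kd_n\big(\tfrac{m_k}{d_k}+\tfrac{m_{kj}}{d_{kj}}\big)\epsilon^{-1}X_jY_k, &&j>k, \end{align*} where $d_jd_n(1-\epsilon_j)^{-d_j}$, a priori in the fraction field, is an element of $T$, and it satisfies,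 for all $1\le j,k\le n$, \[ \{Z_j,X_k\}=-\delta_{k\le j}\,m_kd_jd_n\epsilon^{-1}Z_jX_k,\qquad \{Z_j,Y_k\}=\delta_{k\le j}\,m_kd_jd_n\epsilon^{-1}Z_jY_k,\qquad \{Z_j,Z_k\}=0, \] where $\delta_{k\le j}$ is $1$ if $k\le j$ and $0$ otherwise. -/

import Mathlib

namespace QWeyl

section Algebra

variable {R : Type*} [CommRing R] {n : ℕ}

/-- The free generator `x_j`. -/
def fx (R : Type*) [CommRing R] {n : ℕ} (j : Fin n) : FreeAlgebra R (Fin n ⊕ Fin n) :=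
  FreeAlgebra.ι R (Sum.inl j)

/-- The free generator `y_j`. -/
def fy (R : Type*) [CommRing R] {n : ℕ} (j : Fin n) : FreeAlgebra R (Fin n ⊕ Fin n) :=
  FreeAlgebra.ι R (Sum.inr j)

/-- The defining relations of the multiparameter quantized Weyl algebra with parameters
`E = (ε_j)` and `B = (β_jk)`. -/
inductive Rel (E : Fin n → Rˣ) (B : Fin n → Fin n → Rˣ) :
    FreeAlgebra R (Fin n ⊕ Fin n) → FreeAlgebra R (Fin n ⊕ Fin n) → Prop
  | yy (j k : Fin n) :
      Rel E B (fy R j * fy R k) ((B j k : R) • (fy R k * fy R j))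
  | xx (j k : Fin n) (h : j < k) :
      Rel E B (fx R j * fx R k) ((E j * B j k : R) • (fx R k * fx R j))
  | xy_lt (j k : Fin n) (h : j < k) :
      Rel E B (fx R j * fy R k) ((B k j : R) • (fy R k * fx R j))
  | xy_gt (j k : Fin n) (h : k < j) :
      Rel E B (fx R j * fy R k) ((E k * B k j : R) • (fy R k * fx R j))
  | xy (j : Fin n) :
      Rel E B (fx R j * fy R j - (E j : R) • (fy R j * fx R j))
        (1 + ∑ i ∈ Finset.Iio j, ((E i : R) - 1) • (fy R i * fx R i))

end Algebra

/-- The multiparameter quantized Weyl algebra `A_n^{E,B}(R)`. -/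
def Weyl {R : Type*} [CommRing R] {n : ℕ} (E : Fin n → Rˣ) (B : Fin n → Fin n → Rˣ) : Type _ :=
  RingQuot (Rel E B)

section Algebra

variable {R : Type*} [CommRing R] {n : ℕ}

noncomputable instance (E : Fin n → Rˣ) (B : Fin n → Fin n → Rˣ) : Ring (Weyl E B) :=
  inferInstanceAs (Ring (RingQuot (Rel E B)))

noncomputable instance (E : Fin n → Rˣ) (B : Fin n → Fin n → Rˣ) : Algebra R (Weyl E B) :=
  inferInstanceAs (Algebra R (RingQuot (Rel E B)))

/-- The quotient map from the free algebra. -/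
noncomputable def mk (E : Fin n → Rˣ) (B : Fin n → Fin n → Rˣ) :
    FreeAlgebra R (Fin n ⊕ Fin n) →ₐ[R] Weyl E B :=
  RingQuot.mkAlgHom R (Rel E B)

/-- The generator `x_j` of the quantized Weyl algebra. -/
noncomputable def x (E : Fin n → Rˣ) (B : Fin n → Fin n → Rˣ) (j : Fin n) : Weyl E B :=
  mk E B (fx R j)

/-- The generator `y_j` of the quantized Weyl algebra. -/
noncomputable def y (E : Fin n → Rˣ) (B : Fin n → Fin n → Rˣ) (j : Fin n) : Weyl E B :=
  mk E B (fy R j)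

/-- The normal element `z_j = 1 + (ε_1 - 1) y_1 x_1 + ⋯ + (ε_j - 1) y_j x_j`. -/
noncomputable def z (E : Fin n → Rˣ) (B : Fin n → Fin n → Rˣ) (j : Fin n) : Weyl E B :=
  1 + ∑ i ∈ Finset.Iic j, ((E i : R) - 1) • (y E B i * x E B i)

theorem mk_fx (E : Fin n → Rˣ) (B : Fin n → Fin n → Rˣ) (j : Fin n) :
    mk E B (fx R j) = x E B j := rfl

theorem mk_fy (E : Fin n → Rˣ) (B : Fin n → Fin n → Rˣ) (j : Fin n) :
    mk E B (fy R j) = y E B j := rfl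

theorem rel_mk {E : Fin n → Rˣ} {B : Fin n → Fin n → Rˣ} {a b : FreeAlgebra R (Fin n ⊕ Fin n)}
    (h : Rel E B a b) : mk E B a = mk E B b :=
  RingQuot.mkAlgHom_rel R h

/-- Change of base ring along `φ : R →+* S`, sending `x_j ↦ x_j`, `y_j ↦ y_j` and acting as `φ` on
scalars. -/
noncomputable def baseChange {S : Type*} [CommRing S] (φ : R →+* S)
    {E : Fin n → Rˣ} {B : Fin n → Fin n → Rˣ} {E' : Fin n → Sˣ} {B' : Fin n → Fin n → Sˣ}
    (hE : ∀ j, φ (E j) = E' j) (hB : ∀ j k, φ (B j k) = B' j k) : Weyl E B →+* Weyl E' B' :=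
  letI : Algebra R (Weyl E' B') :=
    ((algebraMap S (Weyl E' B')).comp φ).toAlgebra' (fun r a => Algebra.commutes (φ r) a)
  have hs : ∀ (r : R) (a : Weyl E' B'), r • a = φ r • a := fun r a => by
    rw [Algebra.smul_def, Algebra.smul_def]; rfl
  ((RingQuot.liftAlgHom R
    ⟨FreeAlgebra.lift R (Sum.elim (x E' B') (y E' B')), by
      intro a b h
      have lx : ∀ j, FreeAlgebra.lift R (Sum.elim (x E' B') (y E' B')) (fx R j) = x E' B' j :=
        fun j => by simp [fx]
      have ly : ∀ j, FreeAlgebra.lift R (Sum.elim (x E' B') (y E' B')) (fy R j) = y E' B' j :=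
        fun j => by simp [fy]
      cases h with
      | yy j k =>
        have := rel_mk (Rel.yy (E := E') (B := B') j k)
        simpa only [map_mul, map_smul, lx, ly, hs, hB, hE, mk_fx, mk_fy] using this
      | xx j k h =>
        have := rel_mk (Rel.xx (E := E') (B := B') j k h)
        simpa only [map_mul, map_smul, lx, ly, hs, hB, hE, mk_fx, mk_fy] using this
      | xy_lt j k h =>
        have := rel_mk (Rel.xy_lt (E := E') (B := B') j k h)
        simpa only [map_mul, map_smul, lx, ly, hs, hB, hE, mk_fx, mk_fy] using this
      | xy_gt j k h =>
        have := rel_mk (Rel.xy_gt (E := E') (B := B') j k h)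
        simpa only [map_mul, map_smul, lx, ly, hs, hB, hE, mk_fx, mk_fy] using this
      | xy j =>
        have := rel_mk (Rel.xy (E := E') (B := B') j)
        simpa only [map_mul, map_smul, map_sub, map_add, map_sum, map_one, lx, ly, hs, hB,
          hE, mk_fx, mk_fy]
          using this⟩ : RingQuot (Rel E B) →ₐ[R] Weyl E' B') : RingQuot (Rel E B) →+* Weyl E' B')

end Algebra

section BaseChangeApply

variable {R S : Type*} [CommRing R] [CommRing S] {n : ℕ} (φ : R →+* S)
  {E : Fin n → Rˣ} {B : Fin n → Fin n → Rˣ} {E' : Fin n → Sˣ} {B' : Fin n → Fin n → Sˣ}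
  (hE : ∀ j, φ (E j) = E' j) (hB : ∀ j k, φ (B j k) = B' j k)

theorem baseChange_x (j : Fin n) : baseChange φ hE hB (x E B j) = x E' B' j := by
  let _ : Algebra R (Weyl E' B') :=
    ((algebraMap S (Weyl E' B')).comp φ).toAlgebra' (fun r a => Algebra.commutes (φ r) a)
  refine (RingQuot.liftAlgHom_mkAlgHom_apply R _ _ _).trans ?_
  simp [fx]

theorem baseChange_y (j : Fin n) : baseChange φ hE hB (y E B j) = y E' B' j := by
  let _ : Algebra R (Weyl E' B') :=
    ((algebraMap S (Weyl E' B')).comp φ).toAlgebra' (fun r a => Algebra.commutes (φ r) a)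
  refine (RingQuot.liftAlgHom_mkAlgHom_apply R _ _ _).trans ?_
  simp [fy]

theorem baseChange_algebraMap (r : R) :
    baseChange φ hE hB (algebraMap R (Weyl E B) r) = algebraMap S (Weyl E' B') (φ r) := by
  let _ : Algebra R (Weyl E' B') :=
    ((algebraMap S (Weyl E' B')).comp φ).toAlgebra' (fun r a => Algebra.commutes (φ r) a)
  exact AlgHom.commutes (RingQuot.liftAlgHom R _ : RingQuot (Rel E B) →ₐ[R] Weyl E' B') r

end BaseChangeApply

section Scalars

/-- The index of the last pair of generators, so that `d (lastIdx n)` is `d_n`. -/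
def lastIdx (n : ℕ) [NeZero n] : Fin n := ⟨n - 1, Nat.sub_lt (NeZero.pos n) one_pos⟩

variable {n : ℕ} [NeZero n]

/-- The family `u ^ (d_n m_j / d_j)`. For `u = ε = exp(2πi/d_n)` this is `ε_j`. -/
def parE {U : Type*} [Group U] (u : U) (m d : Fin n → ℕ) (j : Fin n) : U :=
  u ^ (d (lastIdx n) / d j * m j)

/-- The family `u ^ (d_n m_jk / d_jk)`. For `u = ε = exp(2πi/d_n)` this is `β_jk`. -/
def parB {U : Type*} [Group U] (u : U) (d : Fin n → ℕ) (mm : Fin n → Fin n → ℤ)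
    (dd : Fin n → Fin n → ℕ) (j k : Fin n) : U :=
  u ^ (((d (lastIdx n) / dd j k : ℕ) : ℤ) * mm j k)

open LaurentPolynomial in
/-- The indeterminate `q` as a unit of `T[q, q⁻¹]`. -/
noncomputable def qUnit (T : Type*) [CommRing T] : (LaurentPolynomial T)ˣ where
  val := LaurentPolynomial.T 1
  inv := LaurentPolynomial.T (-1)
  val_inv := by rw [← LaurentPolynomial.T_add]; simp
  inv_val := by rw [← LaurentPolynomial.T_add]; simp

/-- Evaluation `q ↦ ε` on Laurent polynomials. -/
noncomputable def evalQ {T : Type*} [CommRing T] (ε : Tˣ) : LaurentPolynomial T →+* T :=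
  LaurentPolynomial.eval₂ (RingHom.id T) ε

theorem map_evalQ_qUnit {T : Type*} [CommRing T] (ε : Tˣ) :
    Units.map (evalQ ε : LaurentPolynomial T →* T) (qUnit T) = ε := by
  ext
  have h := LaurentPolynomial.eval₂_T (RingHom.id T) ε 1
  rw [zpow_one] at h
  exact h

variable {T : Type*} [CommRing T]

/-- `A_n^{E,B}(T)` with `ε_j = ε^{d_n m_j / d_j}` and `β_jk = ε^{d_n m_jk / d_jk}`. -/
abbrev WeylAt (ε : Tˣ) (m d : Fin n → ℕ) (mm : Fin n → Fin n → ℤ) (dd : Fin n → Fin n → ℕ) :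
    Type _ :=
  Weyl (parE ε m d) (parB ε d mm dd)

/-- The algebra `A_n^{E,B}(T)_q` over `T[q, q⁻¹]`. -/
abbrev WeylQ (T : Type*) [CommRing T] (m d : Fin n → ℕ) (mm : Fin n → Fin n → ℤ)
    (dd : Fin n → Fin n → ℕ) : Type _ :=
  Weyl (parE (qUnit T) m d) (parB (qUnit T) d mm dd)

/-- The specialization map `σ : A_n^{E,B}(T)_q → A_n^{E,B}(T)`, `q ↦ ε`. -/
noncomputable def spec (ε : Tˣ) (m d : Fin n → ℕ) (mm : Fin n → Fin n → ℤ)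
    (dd : Fin n → Fin n → ℕ) : WeylQ T m d mm dd →+* WeylAt ε m d mm dd :=
  baseChange (evalQ ε)
    (fun j => by
      have h := congrArg Units.val (congrArg (fun u => parE u m d j) (map_evalQ_qUnit ε))
      simp only [parE, ← map_pow, Units.coe_map] at h
      exact h)
    (fun j k => by
      have h := congrArg Units.val (congrArg (fun u => parB u d mm dd j k) (map_evalQ_qUnit ε))
      simp only [parB, ← map_zpow, Units.coe_map] at h
      exact h)

theorem spec_x (ε : Tˣ) (m d : Fin n → ℕ) (mm : Fin n → Fin n → ℤ) (dd : Fin n → Fin n → ℕ)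
    (j : Fin n) : spec ε m d mm dd (x _ _ j) = x _ _ j :=
  baseChange_x _ _ _ j

theorem spec_y (ε : Tˣ) (m d : Fin n → ℕ) (mm : Fin n → Fin n → ℤ) (dd : Fin n → Fin n → ℕ)
    (j : Fin n) : spec ε m d mm dd (y _ _ j) = y _ _ j :=
  baseChange_y _ _ _ j

theorem spec_algebraMap (ε : Tˣ) (m d : Fin n → ℕ) (mm : Fin n → Fin n → ℤ)
    (dd : Fin n → Fin n → ℕ) (f : LaurentPolynomial T) :
    spec ε m d mm dd (algebraMap _ _ f) = algebraMap T _ (evalQ ε f) :=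
  baseChange_algebraMap _ _ _ f

/-- The element `q - ε` of `A_n^{E,B}(T)_q`. -/
noncomputable def qSub (ε : Tˣ) (m d : Fin n → ℕ) (mm : Fin n → Fin n → ℤ)
    (dd : Fin n → Fin n → ℕ) : WeylQ T m d mm dd :=
  algebraMap (LaurentPolynomial T) _ (LaurentPolynomial.T 1 - LaurentPolynomial.C (ε : T))

end Scalars

section Poisson

/-- A Poisson bracket on a commutative `T`-algebra. -/
structure PoissonBracket (T P : Type*) [CommRing T] [CommRing P] [Algebra T P] where
  /-- the bracket -/
  br : P →ₗ[T] P →ₗ[T] P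
  self : ∀ a, br a a = 0
  jacobi : ∀ a b c, br a (br b c) + br b (br c a) + br c (br a b) = 0
  leibniz : ∀ a b c, br a (b * c) = br a b * c + b * br a c

/-- `σ : A' → A` realizes `A` as the quotient of `A'` by `h A'`. -/
def IsSpecialization {A' A : Type*} [Ring A'] [Ring A] (σ : A' →+* A) (h : A') : Prop :=
  Function.Surjective σ ∧ ∀ a, σ a = 0 ↔ ∃ u, a = h * u

/-- The bracket on the center of `A` is the one induced by the specialization `σ : A' → A` with
kernel `h A'`: `{z, w} = σ ((c c' - c' c) / h)` for all lifts `c` of `z` and `c'` of `w`. -/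
def IsInduced {T A' A : Type*} [CommRing T] [Ring A'] [Ring A] [Algebra T A] (σ : A' →+* A)
    (h : A') (P : PoissonBracket T (Subalgebra.center T A)) : Prop :=
  ∀ (z w : Subalgebra.center T A) (c c' : A'), σ c = z → σ c' = w →
    (∃ u, h * u = c * c' - c' * c) ∧
    ∀ u, h * u = c * c' - c' * c → (P.br z w : A) = σ u

end Poisson

/-- The exponent `d_j / d_{j-1}` of the recursion for `Z_j`, with `d_0 = 1` (the value of `d_0` is
immaterial as `Z_0 = 1`). -/
def ratio {n : ℕ} (d : Fin n → ℕ) (j : Fin n) : ℕ :=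
  d j / (Fin.cons 1 d : Fin (n + 1) → ℕ) j.castSucc

/-- The sequence `Z_0 = 1`, `Z_j = -(1 - ε_j)^{d_j} Y_j X_j + Z_{j-1}^{d_j / d_{j-1}}`. For
`j : Fin n`, `Zseq … j.succ` is the element attached to the same pair as `X j`, `Y j`, and
`Zseq … j.castSucc` is its predecessor. -/
def Zseq {T C : Type*} [CommRing T] [Ring C] [Algebra T C] {n : ℕ} (E : Fin n → Tˣ)
    (d : Fin n → ℕ) (X Y : Fin n → C) : Fin (n + 1) → C :=
  Fin.induction 1 fun j Zprev => -((1 - (E j : T)) ^ d j • (Y j * X j)) + Zprev ^ ratio d j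

end QWeyl

/-! The argument has three parts: a basis of normally ordered monomials, a determination of the
center, and a calculus of brackets in which almost everything reduces to commutation up to a power
of `q`.

Basis. Give `x_j` and `y_j` a weight increasing with `j`. The defining relations then say that
generators commute up to units modulo lower weight, so ordered monomials span. For independence, let
the algebra act on vectors `e_a`, `a ∈ ℤ^n`, over `K[t_1, …, t_n]`: `y_j` shifts `a` up, `x_j`
shifts it down, and `z_j` is diagonal with eigenvalue a character times `t_j`. Applied to `e_0`,
distinct ordered monomials have distinct leading terms (`linearIndependent_normalWord`). Freeness of
both algebras gives the kernel of the specialization (`isSpecialization_spec`) and regularity of `q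
- ε` (`qSub_regular`), hence the induced bracket (`IsSpecialization.exists_isInduced`).

Center. A top-weight monomial of a central element must commute with every generator at the level of
the scalars. Since the orders `d_j` form a divisibility chain, all its exponents are then multiples
of the `d_j` (`RootParams.dvd_of_forall_prod_eq_one`). Subtracting monomials in the central `X_j`,
`Y_j` and descending in weight shows that these generate the center; their leading monomials are
distinct, so they are algebraically independent.

Brackets. If lifts satisfy `c c' = q^N c' c` and `ε^N = 1`, then `{z, w} = N ε⁻¹ z w`, because `(q^N
- 1)/(q - ε)` takes the value `N ε⁻¹` at `ε` (`IsInduced.br_eq_of_qCommute`). This covers every pair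
except `X_j`, `Y_j`, including those with the normal elements `z_j`. The factorization of `z_{j-1}^d
- z_j^d` over the roots of unity identifies `z_j^{d_j}` with `Z_j` (`smul_y_pow_mul_x_pow`,
`RootParams.coe_Zseq`). Finally `{X_j, Y_j}` is recovered from `{Z_j, X_j}` by the Leibniz rule and
cancellation in the center, a polynomial ring over a domain (`PoissonBracket.br_eq_of_cancel`). -/

namespace QWeyl

/-! ### Weight filtrations of algebras whose generators commute up to units and lower terms -/

section Filtration

variable {R A ι : Type*} [CommRing R] [Ring A] [Algebra R A]

/-- The product of the generators along a word. -/
def word (gen : ι → A) (l : List ι) : A := (l.map gen).prod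

/-- The weight of a word. -/
def wordWeight (w : ι → ℕ) (l : List ι) : ℕ := (l.map w).sum

/-- The span of all words of weight less than `k`. -/
def filt (R : Type*) {A ι : Type*} [CommRing R] [Ring A] [Algebra R A] (gen : ι → A) (w : ι → ℕ)
    (k : ℕ) : Submodule R A :=
  Submodule.span R (word gen '' {l | wordWeight w l < k})

/-- A chosen normally ordered monomial for each multiset of generators. -/
noncomputable def normalWord (gen : ι → A) (s : Multiset ι) : A := word gen s.toList

/-- The weight of a multiset of generators. -/
def multisetWeight (w : ι → ℕ) (s : Multiset ι) : ℕ := (s.map w).sum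

variable {gen : ι → A} {w : ι → ℕ}

@[simp] theorem word_nil : word gen [] = 1 := rfl

@[simp] theorem word_cons (i : ι) (l : List ι) : word gen (i :: l) = gen i * word gen l := by
  simp [word]

theorem word_append (l l' : List ι) : word gen (l ++ l') = word gen l * word gen l' := by
  simp [word]

@[simp] theorem wordWeight_nil : wordWeight w [] = 0 := rfl

@[simp] theorem wordWeight_cons (i : ι) (l : List ι) :
    wordWeight w (i :: l) = w i + wordWeight w l := by
  simp [wordWeight]

theorem wordWeight_append (l l' : List ι) :
    wordWeight w (l ++ l') = wordWeight w l + wordWeight w l' := by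
  simp [wordWeight]

theorem wordWeight_perm {l l' : List ι} (h : l.Perm l') : wordWeight w l = wordWeight w l' :=
  (h.map w).sum_eq

theorem wordWeight_toList (s : Multiset ι) : wordWeight w s.toList = multisetWeight w s := by
  rw [wordWeight, multisetWeight]
  conv_rhs => rw [← Multiset.coe_toList s]
  simp

theorem multisetWeight_coe (l : List ι) : multisetWeight w (l : Multiset ι) = wordWeight w l := by
  simp [wordWeight, multisetWeight]

theorem multisetWeight_add (s t : Multiset ι) :
    multisetWeight w (s + t) = multisetWeight w s + multisetWeight w t := by
  simp [multisetWeight]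

theorem word_mem_filt {l : List ι} {k : ℕ} (h : wordWeight w l < k) :
    word gen l ∈ filt R gen w k :=
  Submodule.subset_span ⟨l, h, rfl⟩

theorem filt_mono {k k' : ℕ} (h : k ≤ k') : filt R gen w k ≤ filt R gen w k' :=
  Submodule.span_mono (Set.image_mono fun _ hl => lt_of_lt_of_le hl h)

theorem word_mul_mem_filt (l : List ι) {k : ℕ} {a : A} (ha : a ∈ filt R gen w k) :
    word gen l * a ∈ filt R gen w (wordWeight w l + k) := by
  induction ha using Submodule.span_induction with
  | mem x hx =>
    obtain ⟨l', hl', rfl⟩ := hx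
    rw [← word_append]
    refine word_mem_filt ?_
    rw [wordWeight_append]
    exact Nat.add_lt_add_left hl' _
  | zero => simp
  | add x y _ _ hx hy => rw [mul_add]; exact add_mem hx hy
  | smul r x _ hx => rw [mul_smul_comm]; exact Submodule.smul_mem _ _ hx

theorem mul_word_mem_filt (l : List ι) {k : ℕ} {a : A} (ha : a ∈ filt R gen w k) :
    a * word gen l ∈ filt R gen w (k + wordWeight w l) := by
  induction ha using Submodule.span_induction with
  | mem x hx =>
    obtain ⟨l', hl', rfl⟩ := hx
    rw [← word_append]
    refine word_mem_filt ?_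
    rw [wordWeight_append]
    exact Nat.add_lt_add_right hl' _
  | zero => simp
  | add x y _ _ hx hy => rw [add_mul]; exact add_mem hx hy
  | smul r x _ hx => rw [smul_mul_assoc]; exact Submodule.smul_mem _ _ hx

theorem gen_mul_mem_filt (i : ι) {k : ℕ} {a : A} (ha : a ∈ filt R gen w k) :
    gen i * a ∈ filt R gen w (w i + k) := by
  simpa using word_mul_mem_filt [i] ha

/-- The generators commute up to the scalars `χ` and terms of lower weight. -/
def SkewCommute (gen : ι → A) (w : ι → ℕ) (χ : ι → ι → Rˣ) : Prop :=
  ∀ g h, gen g * gen h - (χ g h : R) • (gen h * gen g) ∈ filt R gen w (w g + w h)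

variable {χ : ι → ι → Rˣ}

/-- Each adjacent transposition costs one unit and an error of lower weight. Multiplying the error
by the untouched letters keeps it below the weight of the whole word. -/
theorem SkewCommute.word_perm (H : SkewCommute gen w χ) {l l' : List ι} (h : l.Perm l') :
    ∃ u : Rˣ, word gen l - (u : R) • word gen l' ∈ filt R gen w (wordWeight w l) := by
  induction h with
  | nil => exact ⟨1, by simp⟩
  | cons i _ ih =>
    obtain ⟨u, hu⟩ := ih
    refine ⟨u, ?_⟩
    have := gen_mul_mem_filt i hu
    simpa [mul_sub] using this
  | swap i j l =>
    refine ⟨χ j i, ?_⟩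
    have := mul_word_mem_filt l (H j i)
    simpa [sub_mul, mul_assoc, add_assoc] using this
  | trans h₁ _ ih₁ ih₂ =>
    obtain ⟨u, hu⟩ := ih₁
    obtain ⟨v, hv⟩ := ih₂
    refine ⟨u * v, ?_⟩
    rw [← wordWeight_perm h₁] at hv
    have := add_mem hu (Submodule.smul_mem _ (u : R) hv)
    simpa [smul_sub, smul_smul] using this

theorem SkewCommute.word_mul_gen (H : SkewCommute gen w χ) (l : List ι) (g : ι) :
    word gen l * gen g - (((l.map fun h => χ h g).prod : Rˣ) : R) • (gen g * word gen l) ∈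
      filt R gen w (wordWeight w l + w g) := by
  induction l with
  | nil => simp
  | cons i l ih =>
    have h₁ := gen_mul_mem_filt i ih
    have h₂ := Submodule.smul_mem _ (((l.map fun h => χ h g).prod : Rˣ) : R)
      (mul_word_mem_filt l (H i g))
    rw [← add_assoc] at h₁
    rw [add_right_comm] at h₂
    have := add_mem h₁ h₂
    simp only [mul_sub, sub_mul, smul_sub, smul_smul, mul_smul_comm, smul_mul_assoc, mul_assoc,
      sub_add_sub_cancel] at this
    simpa only [word_cons, wordWeight_cons, List.map_cons, List.prod_cons, Units.val_mul,
      mul_assoc, mul_comm] using this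

/-- Sorting a word produces an error of strictly smaller weight, which the induction on `k` has
already expressed in sorted words. -/
theorem SkewCommute.filt_eq_span (H : SkewCommute gen w χ) (k : ℕ) :
    filt R gen w k = Submodule.span R (normalWord gen '' {s | multisetWeight w s < k}) := by
  refine le_antisymm ?_ ?_
  · induction k with
    | zero => simp [filt]
    | succ k ih =>
      refine Submodule.span_le.2 ?_
      rintro _ ⟨l, hl, rfl⟩
      have hp : l.Perm (l : Multiset ι).toList :=
        Multiset.coe_eq_coe.1 (Multiset.coe_toList _).symm
      obtain ⟨u, hu⟩ := H.word_perm hp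
      have hu := filt_mono (Nat.lt_succ_iff.1 hl) hu
      have hu := (ih.trans (Submodule.span_mono
        (Set.image_mono fun s (hs : _ < k) => hs.trans (Nat.lt_succ_self k)))) hu
      have he : normalWord gen (l : Multiset ι) ∈
          Submodule.span R (normalWord gen '' {s | multisetWeight w s < k + 1}) :=
        Submodule.subset_span ⟨_, by simpa [multisetWeight_coe] using hl, rfl⟩
      have := add_mem hu (Submodule.smul_mem _ (u : R) he)
      rwa [normalWord, sub_add_cancel] at this
  · refine Submodule.span_le.2 ?_
    rintro _ ⟨s, hs, rfl⟩
    exact word_mem_filt (by rw [wordWeight_toList]; exact hs)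

theorem exists_mem_filt (hgen : Algebra.adjoin R (Set.range gen) = ⊤) (a : A) :
    ∃ k, a ∈ filt R gen w k := by
  have ha : a ∈ Algebra.adjoin R (Set.range gen) := hgen ▸ Algebra.mem_top
  rw [← Subalgebra.mem_toSubmodule, Algebra.adjoin_eq_span] at ha
  induction ha using Submodule.span_induction with
  | mem x hx =>
    suffices ∃ l, x = word gen l by
      obtain ⟨l, rfl⟩ := this
      exact ⟨_, word_mem_filt (Nat.lt_succ_self _)⟩
    induction hx using Submonoid.closure_induction with
    | mem x hx => obtain ⟨i, rfl⟩ := hx; exact ⟨[i], by simp⟩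
    | one => exact ⟨[], rfl⟩
    | mul x y _ _ hx hy =>
      obtain ⟨l, rfl⟩ := hx
      obtain ⟨l', rfl⟩ := hy
      exact ⟨l ++ l', (word_append _ _).symm⟩
  | zero => exact ⟨0, zero_mem _⟩
  | add x y _ _ hx hy =>
    obtain ⟨k, hk⟩ := hx
    obtain ⟨k', hk'⟩ := hy
    exact ⟨max k k', add_mem (filt_mono (le_max_left _ _) hk) (filt_mono (le_max_right _ _) hk')⟩
  | smul r x _ hx =>
    obtain ⟨k, hk⟩ := hx
    exact ⟨k, Submodule.smul_mem _ _ hk⟩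

theorem SkewCommute.span_normalWord (H : SkewCommute gen w χ)
    (hgen : Algebra.adjoin R (Set.range gen) = ⊤) :
    Submodule.span R (Set.range (normalWord gen)) = ⊤ := by
  refine eq_top_iff.2 fun a _ => ?_
  obtain ⟨k, hk⟩ := exists_mem_filt (w := w) hgen a
  rw [H.filt_eq_span] at hk
  exact Submodule.span_mono (Set.image_subset_range _ _) hk

/-- `a` is a unit multiple of the normally ordered monomial of `s` plus terms of lower weight. -/
def HasLeading (gen : ι → A) (w : ι → ℕ) (R : Type*) [CommRing R] [Algebra R A] (s : Multiset ι)
    (a : A) : Prop :=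
  ∃ u : Rˣ, a - (u : R) • normalWord gen s ∈ filt R gen w (multisetWeight w s)

theorem SkewCommute.hasLeading_word (H : SkewCommute gen w χ) (l : List ι) :
    HasLeading gen w R (l : Multiset ι) (word gen l) := by
  have hp : l.Perm (l : Multiset ι).toList := Multiset.coe_eq_coe.1 (Multiset.coe_toList _).symm
  rw [HasLeading, multisetWeight_coe]
  exact H.word_perm hp

theorem SkewCommute.hasLeading_one (H : SkewCommute gen w χ) :
    HasLeading gen w R (0 : Multiset ι) 1 := H.hasLeading_word []

theorem SkewCommute.hasLeading_gen (H : SkewCommute gen w χ) (i : ι) :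
    HasLeading gen w R {i} (gen i) := by
  simpa using H.hasLeading_word [i]

theorem filt_mul_mem {k k' : ℕ} {a b : A} (ha : a ∈ filt R gen w k) (hb : b ∈ filt R gen w k') :
    a * b ∈ filt R gen w (k + k') := by
  induction ha using Submodule.span_induction with
  | mem x hx =>
    obtain ⟨l, hl, rfl⟩ := hx
    exact filt_mono (Nat.add_le_add_right (le_of_lt hl) _) (word_mul_mem_filt l hb)
  | zero => simp
  | add x y _ _ hx hy => rw [add_mul]; exact add_mem hx hy
  | smul r x _ hx => rw [smul_mul_assoc]; exact Submodule.smul_mem _ _ hx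

theorem SkewCommute.hasLeading_mul (H : SkewCommute gen w χ) {s t : Multiset ι} {a b : A}
    (ha : HasLeading gen w R s a) (hb : HasLeading gen w R t b) :
    HasLeading gen w R (s + t) (a * b) := by
  obtain ⟨u, hu⟩ := ha
  obtain ⟨v, hv⟩ := hb
  obtain ⟨r, hr⟩ := H.hasLeading_word (s.toList ++ t.toList)
  rw [← Multiset.coe_add, Multiset.coe_toList, Multiset.coe_toList, word_append] at hr
  refine ⟨u * v * r, ?_⟩
  rw [multisetWeight_add] at hr ⊢
  have h₁ := filt_mul_mem hu hv
  have h₂ := Submodule.smul_mem _ (v : R) (mul_word_mem_filt t.toList hu)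
  have h₃ := Submodule.smul_mem _ (u : R) (word_mul_mem_filt s.toList hv)
  rw [wordWeight_toList] at h₂ h₃
  have h₄ := Submodule.smul_mem _ ((u : R) * v) hr
  convert add_mem (add_mem h₁ h₂) (add_mem h₃ h₄) using 1
  simp only [normalWord, mul_sub, sub_mul, smul_sub, mul_smul_comm, smul_mul_assoc, smul_smul,
    Units.val_mul, mul_comm (v : R) u]
  abel

theorem SkewCommute.hasLeading_pow (H : SkewCommute gen w χ) {s : Multiset ι} {a : A}
    (ha : HasLeading gen w R s a) (k : ℕ) : HasLeading gen w R (k • s) (a ^ k) := by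
  induction k with
  | zero => simpa using H.hasLeading_one
  | succ k ih => rw [pow_succ, succ_nsmul]; exact H.hasLeading_mul ih ha

end Filtration

/-! ### Linear independence from leading terms -/

section Triangular

variable {R M J I : Type*} [CommRing R] [IsDomain R] [AddCommGroup M] [Module R M]

/-- A family which is triangular with respect to a linearly independent one is linearly
independent. -/
theorem linearIndependent_of_triangular {e : J → M} (he : LinearIndependent R e) (wt : J → ℕ)
    {v : I → M} {φ : I → J} (hφ : Function.Injective φ) {u : I → R} (hu : ∀ i, u i ≠ 0)
    (hv : ∀ i, v i - u i • e (φ i) ∈ Submodule.span R (e '' {j | wt j < wt (φ i)})) :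
    LinearIndependent R v := by
  classical
  have hlow : ∀ i, ∃ c : J →₀ R, (∀ j, wt (φ i) ≤ wt j → c j = 0) ∧
      v i = Finsupp.linearCombination R e (c + Finsupp.single (φ i) (u i)) := by
    intro i
    obtain ⟨c, hc, hce⟩ := (Finsupp.mem_span_image_iff_linearCombination R).1 (hv i)
    refine ⟨c, fun j hj => ?_, ?_⟩
    · by_contra h
      exact absurd (hc (Finsupp.mem_support_iff.2 h)) (not_lt.2 hj)
    · rw [map_add, hce, Finsupp.linearCombination_single, sub_add_cancel]
  choose c hc hvc using hlow
  rw [linearIndependent_iff']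
  intro S a hsum
  by_contra! hne
  obtain ⟨i₀, hi₀, ha₀⟩ := hne
  -- At an index of maximal leading weight, no lower part `c i'` with nonzero coefficient reaches `φ
  -- i`, and no other leading term equals it. The coefficient there is thus `a i * u i`, which
  -- cannot vanish.
  obtain ⟨i, hi, hmax⟩ := (S.filter fun i => a i ≠ 0).exists_max_image (fun i => wt (φ i))
    ⟨i₀, by simp [hi₀, ha₀]⟩
  simp only [Finset.mem_filter] at hi hmax
  have hzero : Finsupp.linearCombination R e
      (∑ i ∈ S, a i • (c i + Finsupp.single (φ i) (u i))) = 0 := by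
    rw [map_sum, ← hsum]
    exact Finset.sum_congr rfl fun i _ => by rw [map_smul, ← hvc]
  have := DFunLike.congr_fun (linearIndependent_iff.1 he _ hzero) (φ i)
  rw [Finsupp.finsetSum_apply, Finset.sum_eq_single i] at this
  · simp [hc i (φ i) le_rfl, hi.2, hu i] at this
  · intro i' hi' hii'
    by_cases h : a i' = 0
    · simp [h]
    · have h₁ := hc i' (φ i) (hmax i' ⟨hi', h⟩)
      simp [h₁, hφ.ne hii']
  · exact fun h => absurd hi.1 h

end Triangular

/-! ### Leading monomials of central elements -/

section Center

variable {R A ι : Type*} [CommRing R] [IsDomain R] [Ring A] [Algebra R A]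
variable {gen : ι → A} {w : ι → ℕ} {χ : ι → ι → Rˣ}

/-- On each monomial `t` the commutator with `gen g` has leading coefficient `χ(t, g) - 1` times a
unit, at the monomial `g ::ₘ t`. If the whole commutator vanishes, independence forces this
coefficient to be zero for every `t` of top weight. -/
theorem SkewCommute.eq_one_of_commute (H : SkewCommute gen w χ)
    (hli : LinearIndependent R (normalWord gen)) {k : ℕ} {c : Multiset ι →₀ R}
    (hck : ∀ s ∈ c.support, multisetWeight w s ≤ k) {g : ι}
    (hcomm : Finsupp.linearCombination R (normalWord gen) c * gen g =
      gen g * Finsupp.linearCombination R (normalWord gen) c)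
    {s : Multiset ι} (hs : s ∈ c.support) (hsk : multisetWeight w s = k) :
    (s.map fun h => χ h g).prod = 1 := by
  classical
  have hX : ∀ t : Multiset ι, (((t.toList).map fun h => χ h g).prod) =
      (t.map fun h => χ h g).prod := by
    intro t
    conv_rhs => rw [← Multiset.coe_toList t]
    simp
  have hlead : ∀ t : Multiset ι, ∃ u : Rˣ, gen g * normalWord gen t -
      (u : R) • normalWord gen (g ::ₘ t) ∈ filt R gen w (multisetWeight w t + w g) := by
    intro t
    obtain ⟨u, hu⟩ := H.hasLeading_word (g :: t.toList)
    rw [← Multiset.cons_coe, Multiset.coe_toList, word_cons] at hu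
    refine ⟨u, ?_⟩
    have hw : multisetWeight w (g ::ₘ t) = multisetWeight w t + w g := by
      simp [multisetWeight, add_comm]
    rwa [hw] at hu
  choose u hu using hlead
  have hterm : ∀ t ∈ c.support, c t • (normalWord gen t * gen g - gen g * normalWord gen t) -
      (c t * ((((t.map fun h => χ h g).prod : Rˣ) : R) - 1) * u t) • normalWord gen (g ::ₘ t) ∈
      filt R gen w (k + w g) := by
    intro t ht
    have h₁ := H.word_mul_gen t.toList g
    rw [hX, wordWeight_toList] at h₁
    have h₂ := Submodule.smul_mem _ ((((t.map fun h => χ h g).prod : Rˣ) : R) - 1) (hu t)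
    have h₃ := filt_mono (Nat.add_le_add_right (hck t ht) _)
      (Submodule.smul_mem _ (c t) (add_mem h₁ h₂))
    convert h₃ using 1
    simp only [normalWord]
    module
  have hsum := Submodule.sum_mem _ hterm
  rw [Finset.sum_sub_distrib] at hsum
  have h0 : ∑ t ∈ c.support, c t • (normalWord gen t * gen g - gen g * normalWord gen t) = 0 := by
    rw [Finsupp.linearCombination_apply, Finsupp.sum, Finset.sum_mul, Finset.mul_sum] at hcomm
    simp only [smul_sub, Finset.sum_sub_distrib]
    simp only [smul_mul_assoc, mul_smul_comm] at hcomm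
    rw [hcomm, sub_self]
  rw [h0, zero_sub, neg_mem_iff, H.filt_eq_span,
    Finsupp.mem_span_image_iff_linearCombination] at hsum
  obtain ⟨b, hb, hbe⟩ := hsum
  -- `f` collects the leading terms of the commutator, and `b` expresses them through monomials of
  -- weight below `k + w g`. Since `t ↦ g ::ₘ t` is injective, only `t = s` contributes to `f` at `g
  -- ::ₘ s`, where `b` is zero.
  set f : Multiset ι →₀ R := ∑ t ∈ c.support, Finsupp.single (g ::ₘ t)
    (c t * ((((t.map fun h => χ h g).prod : Rˣ) : R) - 1) * u t) with hf
  have hfb : f = b := by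
    refine hli (?_ : Finsupp.linearCombination R _ f = Finsupp.linearCombination R _ b)
    rw [hbe, hf, map_sum]
    simp only [Finsupp.linearCombination_single]
  have hbs : b (g ::ₘ s) = 0 := by
    by_contra h
    have : multisetWeight w (g ::ₘ s) < k + w g := hb (Finsupp.mem_support_iff.2 h)
    simp only [multisetWeight, Multiset.map_cons, Multiset.sum_cons] at this hsk
    omega
  rw [← hfb, hf, Finsupp.finsetSum_apply, Finset.sum_eq_single s] at hbs
  · simp only [Finsupp.single_eq_same, mul_eq_zero, Units.ne_zero, or_false,
      Finsupp.mem_support_iff.1 hs, false_or, sub_eq_zero] at hbs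
    exact Units.ext hbs
  · intro t _ hts
    rw [Finsupp.single_apply, if_neg]
    simpa using hts
  · exact fun h => absurd hs h

/-- The center is contained in a subalgebra which realizes all leading monomials that commute with
the generators up to lower terms. -/
theorem SkewCommute.center_le (H : SkewCommute gen w χ)
    (hgen : Algebra.adjoin R (Set.range gen) = ⊤)
    (hli : LinearIndependent R (normalWord gen)) (S : Subalgebra R A)
    (hS : S ≤ Subalgebra.center R A)
    (hlead : ∀ s : Multiset ι, (∀ g, (s.map fun h => χ h g).prod = 1) →
      ∃ p ∈ S, HasLeading gen w R s p) :
    Subalgebra.center R A ≤ S := by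
  classical
  intro a ha
  obtain ⟨k, hk⟩ := exists_mem_filt (w := w) hgen a
  induction k generalizing a with
  | zero => simp [filt] at hk; subst hk; exact zero_mem _
  | succ k ih =>
    rw [H.filt_eq_span, Finsupp.mem_span_image_iff_linearCombination] at hk
    obtain ⟨c, hc, rfl⟩ := hk
    have hck : ∀ s ∈ c.support, multisetWeight w s ≤ k := fun s hs => Nat.lt_succ_iff.1 (hc hs)
    have hp : ∀ s ∈ c.support, ∃ p ∈ S,
        c s • normalWord gen s - p ∈ filt R gen w k := by
      intro s hs
      by_cases hsk : multisetWeight w s = k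
      · obtain ⟨p, hpS, u, hu⟩ := hlead s fun g => H.eq_one_of_commute hli hck
          ((Subalgebra.mem_center_iff.1 ha (gen g)).symm) hs hsk
        -- The leading coefficient of `p` is the unit `u`, so rescaling by its inverse cancels the
        -- top term exactly.
        refine ⟨(c s * (u⁻¹ : Rˣ)) • p, Subalgebra.smul_mem _ hpS _, ?_⟩
        rw [hsk] at hu
        convert Submodule.smul_mem _ (-(c s * (u⁻¹ : Rˣ))) hu using 1
        rw [smul_sub, smul_smul, neg_mul, mul_assoc, Units.inv_mul, mul_one]
        module
      · refine ⟨0, zero_mem _, ?_⟩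
        rw [sub_zero]
        refine Submodule.smul_mem _ _ (word_mem_filt ?_)
        rw [wordWeight_toList]
        exact lt_of_le_of_ne (hck s hs) hsk
    choose! p hpS hpk using hp
    have hdiff : Finsupp.linearCombination R (normalWord gen) c - ∑ s ∈ c.support, p s ∈
        filt R gen w k := by
      rw [Finsupp.linearCombination_apply, Finsupp.sum, ← Finset.sum_sub_distrib]
      exact Submodule.sum_mem _ hpk
    have hpsum : ∑ s ∈ c.support, p s ∈ S := sum_mem hpS
    have := ih (sub_mem ha (hS hpsum)) hdiff
    simpa using add_mem this hpsum

end Center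

/-! ### Weighted shift operators -/

section Shift

variable {K C G : Type*} [CommRing K] [CommRing C] [Algebra K C] [AddCommGroup G]

/-- The weighted shift `e_a ↦ f a • e_{a + v}` on the free module with basis `e_a`, `a ∈ G`. -/
noncomputable def shift (K : Type*) {C G : Type*} [CommRing K] [CommRing C] [Algebra K C]
    [AddCommGroup G] (v : G) (f : G → C) : Module.End K (G →₀ C) :=
  Finsupp.lsum K fun a => Finsupp.lsingle (a + v) ∘ₗ LinearMap.mulLeft K (f a)

theorem shift_single (v : G) (f : G → C) (a : G) (c : C) :
    shift K v f (Finsupp.single a c) = Finsupp.single (a + v) (f a * c) := by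
  simp [shift]

theorem shift_mul (v u : G) (f g : G → C) :
    shift K v f * shift K u g = shift K (u + v) fun a => f (a + u) * g a := by
  refine Finsupp.lhom_ext fun a c => ?_
  simp only [Module.End.mul_apply, shift_single, add_assoc, mul_assoc]

theorem shift_add (v : G) (f g : G → C) :
    shift K v f + shift K v g = shift K v (f + g) := by
  refine Finsupp.lhom_ext fun a c => ?_
  simp [shift_single, add_mul]

theorem smul_shift (v : G) (f : G → C) (r : K) :
    r • shift K v f = shift K v (r • f) := by
  refine Finsupp.lhom_ext fun a c => ?_
  rw [LinearMap.smul_apply, shift_single, shift_single, Finsupp.smul_single, Pi.smul_apply,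
    smul_mul_assoc]

theorem shift_zero_one : shift K (0 : G) (1 : G → C) = 1 := by
  refine Finsupp.lhom_ext fun a c => ?_
  simp [shift_single]

theorem shift_zero : shift K (0 : G) (0 : G → C) = 0 := by
  refine Finsupp.lhom_ext fun a c => ?_
  simp [shift_single]

theorem sum_shift {ι : Type*} (s : Finset ι) (f : ι → G → C) :
    ∑ i ∈ s, shift K (0 : G) (f i) = shift K 0 (∑ i ∈ s, f i) := by
  classical
  induction s using Finset.induction_on with
  | empty => simp [shift_zero]
  | insert i s hi ih => rw [Finset.sum_insert hi, Finset.sum_insert hi, ih, shift_add]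

end Shift

/-! ### Characters of `ℤ^n` -/

section Character

variable {K : Type*} [CommRing K] {n : ℕ}

/-- The character `a ↦ ∏ k, c_k ^ a_k` of `ℤ^n`. -/
def char (c : Fin n → Kˣ) (a : Fin n → ℤ) : Kˣ := ∏ k, c k ^ a k

theorem char_add (c : Fin n → Kˣ) (a b : Fin n → ℤ) : char c (a + b) = char c a * char c b := by
  simp [char, zpow_add, Finset.prod_mul_distrib]

theorem char_neg (c : Fin n → Kˣ) (a : Fin n → ℤ) : char c (-a) = (char c a)⁻¹ := by
  simp [char]

theorem char_single (c : Fin n → Kˣ) (k : Fin n) : char c (Pi.single k 1) = c k := by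
  rw [char, Finset.prod_eq_single k] <;> simp +contextual

/-- The character of the action of `z_i`. -/
def charZ (E : Fin n → Kˣ) (i : Fin (n + 1)) : (Fin n → ℤ) → Kˣ :=
  char fun k => if k.castSucc < i then E k else 1

/-- The character of the action of `y_j`. -/
def charY (B : Fin n → Fin n → Kˣ) (j : Fin n) : (Fin n → ℤ) → Kˣ :=
  char fun k => if k < j then B j k else 1

end Character

/-! ### A representation by weighted shifts -/

section Rep

variable {K : Type*} [Field K] {n : ℕ} (E : Fin n → Kˣ) (B : Fin n → Fin n → Kˣ)

/-- The variables `t_0 = 1, t_1, …, t_n`. -/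
noncomputable def tvar (K : Type*) [Field K] {n : ℕ} : Fin (n + 1) → MvPolynomial (Fin n) K :=
  Fin.cons 1 MvPolynomial.X

/-- The eigenvalue of `z_i` on the basis vector `e_a`. -/
noncomputable def eigZ (i : Fin (n + 1)) (a : Fin n → ℤ) : MvPolynomial (Fin n) K :=
  (charZ E i a : K) • tvar K i

/-- The eigenvalue of `(ε_j - 1) y_j x_j` on the basis vector `e_a`. -/
noncomputable def eigYX (j : Fin n) (a : Fin n → ℤ) : MvPolynomial (Fin n) K :=
  eigZ E j.succ a - eigZ E j.castSucc a

/-- The operator by which `y_j` acts. -/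
noncomputable def opY (j : Fin n) : Module.End K ((Fin n → ℤ) →₀ MvPolynomial (Fin n) K) :=
  shift K (Pi.single j 1) fun a => (charY B j a : K) • 1

/-- The operator by which `x_j` acts. -/
noncomputable def opX (j : Fin n) : Module.End K ((Fin n → ℤ) →₀ MvPolynomial (Fin n) K) :=
  shift K (-Pi.single j 1) fun a =>
    ((charY B j a : K)⁻¹ * ((E j : K) - 1)⁻¹) • eigYX E j a

variable {E B}

theorem eigYX_add_of_lt {j k : Fin n} (h : k < j) (a : Fin n → ℤ) :
    eigYX E j (a + Pi.single k 1) = (E k : K) • eigYX E j a := by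
  have h₁ : k.castSucc < j.succ := Fin.castSucc_lt_succ_iff.2 h.le
  have h₂ : k.castSucc < j.castSucc := by simpa using h
  simp only [eigYX, eigZ, charZ, char_add, char_single, h₁, h₂, if_true, Units.val_mul,
    smul_sub, smul_smul, mul_comm (E k : K)]

theorem eigYX_add_of_gt {j k : Fin n} (h : j < k) (a : Fin n → ℤ) :
    eigYX E j (a + Pi.single k 1) = eigYX E j a := by
  have h₁ : ¬ k.castSucc < j.succ := by simpa [Fin.castSucc_lt_succ_iff] using h
  have h₂ : ¬ k.castSucc < j.castSucc := by simpa using h.le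
  simp only [eigYX, eigZ, charZ, char_add, char_single, h₁, h₂, if_false, mul_one]

/-- Shifting by `y_j` multiplies the eigenvalue of `z_j` by `ε_j` and fixes that of `z_{j-1}`. This
is the relation between `x_j y_j` and `y_j x_j` in terms of eigenvalues. -/
theorem eigYX_add_self (j : Fin n) (a : Fin n → ℤ) :
    eigYX E j (a + Pi.single j 1) =
      (E j : K) • eigYX E j a + ((E j : K) - 1) • eigZ E j.castSucc a := by
  have h₁ : j.castSucc < j.succ := Fin.castSucc_lt_succ
  have h₂ : ¬ j.castSucc < j.castSucc := lt_irrefl _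
  simp only [eigYX, eigZ, charZ, char_add, char_single, h₁, h₂, if_true, if_false, mul_one,
    Units.val_mul]
  module

theorem eigYX_sub_of_lt {j k : Fin n} (h : k < j) (a : Fin n → ℤ) :
    eigYX E j (a + -Pi.single k 1) = (E k : K)⁻¹ • eigYX E j a := by
  have := eigYX_add_of_lt (E := E) h (a + -Pi.single k 1)
  rw [neg_add_cancel_right] at this
  rw [this, smul_smul, inv_mul_cancel₀ (E k).ne_zero, one_smul]

theorem eigYX_sub_of_gt {j k : Fin n} (h : j < k) (a : Fin n → ℤ) :
    eigYX E j (a + -Pi.single k 1) = eigYX E j a := by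
  have := eigYX_add_of_gt (E := E) h (a + -Pi.single k 1)
  rw [neg_add_cancel_right] at this
  exact this.symm

theorem eigZ_zero (a : Fin n → ℤ) : eigZ E 0 a = 1 := by
  simp [eigZ, charZ, tvar, char]

theorem eigZ_castSucc (j : Fin n) (a : Fin n → ℤ) :
    eigZ E j.castSucc a = 1 + ∑ i ∈ Finset.Iio j, eigYX E i a := by
  have key : ∀ i : Fin (n + 1), eigZ E i a =
      1 + ∑ k with (Fin.castSucc k < i), eigYX E k a := by
    intro i
    induction i using Fin.induction with
    | zero => simp [eigZ_zero]
    | succ i ih =>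
      have hs : Finset.univ.filter (fun k : Fin n => k.castSucc < i.succ) =
          insert i (Finset.univ.filter fun k : Fin n => k.castSucc < i.castSucc) := by
        ext k
        simp [Fin.castSucc_lt_succ_iff, le_iff_eq_or_lt]
      rw [hs, Finset.sum_insert (by simp), add_left_comm, ← ih, eigYX, sub_add_cancel]
  rw [key]
  congr 1
  refine Finset.sum_congr ?_ fun _ _ => rfl
  ext k
  simp

theorem charY_single_of_lt {j k : Fin n} (h : k < j) :
    charY B j (Pi.single k 1) = B j k := by
  simp [charY, char_single, h]

theorem charY_single_of_le {j k : Fin n} (h : j ≤ k) :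
    charY B j (Pi.single k 1) = 1 := by
  simp [charY, char_single, h.not_gt]

theorem charY_add (j : Fin n) (a b : Fin n → ℤ) :
    (charY B j (a + b) : K) = charY B j a * charY B j b := by
  rw [charY, char_add, Units.val_mul]

theorem charY_sub (j : Fin n) (a b : Fin n → ℤ) :
    (charY B j (a + -b) : K) = charY B j a * (charY B j b : K)⁻¹ := by
  rw [charY_add, charY, char_neg, Units.val_inv_eq_inv_val]

/-- The character of `y_j` only sees coordinates `k < j`, so for `j ≠ k` exactly one of the two
orders of multiplication picks up a scalar. -/
theorem opY_mul_opY (hB : ∀ j k, (B j k : K) * B k j = 1) (hB' : ∀ j, B j j = 1) (j k : Fin n) :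
    opY B j * opY B k = (B j k : K) • (opY B k * opY B j) := by
  rw [opY, opY, shift_mul, shift_mul, smul_shift, add_comm (Pi.single k (1 : ℤ) : Fin n → ℤ)]
  congr 1
  funext a
  simp only [Pi.smul_apply, smul_mul_smul_comm, smul_smul, charY_add]
  congr 1
  rcases lt_trichotomy j k with h | rfl | h
  · rw [charY_single_of_le h.le, charY_single_of_lt h, Units.val_one]
    linear_combination -(charY B j a : K) * charY B k a * hB j k
  · rw [hB', Units.val_one, one_mul]
  · rw [charY_single_of_le h.le, charY_single_of_lt h, Units.val_one]
    ring

theorem opX_mul_opX (hB : ∀ j k, (B j k : K) * B k j = 1) {j k : Fin n} (h : j < k) :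
    opX E B j * opX E B k = (E j * B j k : K) • (opX E B k * opX E B j) := by
  rw [opX, opX, shift_mul, shift_mul, smul_shift, add_comm (-Pi.single k (1 : ℤ) : Fin n → ℤ)]
  congr 1
  funext a
  simp only [Pi.smul_apply, smul_mul_smul_comm, smul_smul, charY_sub, eigYX_sub_of_lt h,
    eigYX_sub_of_gt h, charY_single_of_le h.le, charY_single_of_lt h, Units.val_one]
  rw [mul_comm (eigYX E k a)]
  congr 1
  rw [eq_inv_of_mul_eq_one_left (hB j k)]
  have := (E j).ne_zero
  have := (B k j).ne_zero
  have := (charY B j a).ne_zero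
  have := (charY B k a).ne_zero
  field_simp

theorem opX_mul_opY_of_lt {j k : Fin n} (h : j < k) :
    opX E B j * opY B k = (B k j : K) • (opY B k * opX E B j) := by
  rw [opX, opY, shift_mul, shift_mul, smul_shift, add_comm (Pi.single k (1 : ℤ) : Fin n → ℤ)]
  congr 1
  funext a
  simp only [Pi.smul_apply, smul_mul_smul_comm, smul_smul, charY_sub]
  simp only [charY_add, eigYX_add_of_gt h, charY_single_of_le h.le, charY_single_of_lt h,
    Units.val_one]
  rw [mul_comm (eigYX E j a)]
  congr 1
  have := (B k j).ne_zero
  have := (charY B j a).ne_zero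
  field_simp

theorem opX_mul_opY_of_gt (hB : ∀ j k, (B j k : K) * B k j = 1) {j k : Fin n} (h : k < j) :
    opX E B j * opY B k = (E k * B k j : K) • (opY B k * opX E B j) := by
  rw [opX, opY, shift_mul, shift_mul, smul_shift, add_comm (Pi.single k (1 : ℤ) : Fin n → ℤ)]
  congr 1
  funext a
  simp only [Pi.smul_apply, smul_mul_smul_comm, smul_smul, charY_sub]
  simp only [charY_add, eigYX_add_of_lt h, charY_single_of_le h.le, charY_single_of_lt h,
    Units.val_one]
  rw [smul_mul_assoc, smul_smul, mul_comm (eigYX E j a)]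
  congr 1
  rw [eq_inv_of_mul_eq_one_left (hB k j)]
  have := (E k).ne_zero
  have := (B j k).ne_zero
  have := (charY B j a).ne_zero
  field_simp

/-- The coefficients of `opX` were chosen so that the characters cancel here: `y_j x_j` must act as
`(z_j - z_{j-1}) / (ε_j - 1)`. -/
theorem opY_mul_opX (j : Fin n) :
    opY B j * opX E B j = shift K 0 (((E j : K) - 1)⁻¹ • eigYX E j) := by
  rw [opX, opY, shift_mul, neg_add_cancel]
  congr 1
  funext a
  simp only [Pi.smul_apply, smul_mul_smul_comm, charY_sub, charY_single_of_le le_rfl,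
    Units.val_one, one_mul]
  congr 1
  have := (charY B j a).ne_zero
  field_simp

theorem opX_mul_opY_self (hE : ∀ j, (E j : K) ≠ 1) (j : Fin n) :
    opX E B j * opY B j - (E j : K) • (opY B j * opX E B j) =
      1 + ∑ i ∈ Finset.Iio j, ((E i : K) - 1) • (opY B i * opX E B i) := by
  have hE' : ∀ i, (E i : K) - 1 ≠ 0 := fun i => sub_ne_zero.2 (hE i)
  have hxy : opX E B j * opY B j =
      shift K 0 (((E j : K) - 1)⁻¹ • (fun a => eigYX E j (a + Pi.single j 1))) := by
    rw [opX, opY, shift_mul, add_neg_cancel]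
    congr 1
    funext a
    simp only [Pi.smul_apply, smul_mul_smul_comm, charY_add, charY_single_of_le le_rfl,
      Units.val_one, mul_one]
    congr 1
    have := (charY B j a).ne_zero
    field_simp
  simp only [opY_mul_opX, hxy, smul_shift, smul_smul, mul_inv_cancel₀ (hE' _), one_smul]
  rw [sum_shift, ← shift_zero_one, shift_add]
  refine sub_eq_of_eq_add (G := Module.End K ((Fin n → ℤ) →₀ MvPolynomial (Fin n) K)) ?_
  rw [shift_add]
  congr 1
  funext a
  simp only [Pi.smul_apply, Pi.add_apply, Pi.one_apply, Finset.sum_apply]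
  rw [← eigZ_castSucc, eigYX_add_self, smul_add, smul_smul, smul_smul, inv_mul_cancel₀ (hE' j),
    one_smul, add_comm, mul_comm]

/-- The representation of the quantized Weyl algebra by weighted shifts. -/
noncomputable def rep (hE : ∀ j, (E j : K) ≠ 1) (hB : ∀ j k, (B j k : K) * B k j = 1)
    (hB' : ∀ j, B j j = 1) :
    Weyl E B →ₐ[K] Module.End K ((Fin n → ℤ) →₀ MvPolynomial (Fin n) K) :=
  RingQuot.liftAlgHom K ⟨FreeAlgebra.lift K (Sum.elim (opX E B) (opY B)), by
    intro a b h
    have lx : ∀ j, FreeAlgebra.lift K (Sum.elim (opX E B) (opY B)) (fx K j) = opX E B j :=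
      fun j => by simp [fx]
    have ly : ∀ j, FreeAlgebra.lift K (Sum.elim (opX E B) (opY B)) (fy K j) = opY B j :=
      fun j => by simp [fy]
    cases h with
    | yy j k => simpa only [map_mul, map_smul, ly] using opY_mul_opY hB hB' j k
    | xx j k h => simpa only [map_mul, map_smul, lx] using opX_mul_opX hB h
    | xy_lt j k h => simpa only [map_mul, map_smul, lx, ly] using opX_mul_opY_of_lt h
    | xy_gt j k h => simpa only [map_mul, map_smul, lx, ly] using opX_mul_opY_of_gt hB h
    | xy j =>
      simpa only [map_mul, map_smul, map_sub, map_add, map_sum, map_one, lx, ly] using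
        opX_mul_opY_self hE j⟩

theorem rep_x (hE : ∀ j, (E j : K) ≠ 1) (hB : ∀ j k, (B j k : K) * B k j = 1)
    (hB' : ∀ j, B j j = 1) (j : Fin n) : rep hE hB hB' (x E B j) = opX E B j := by
  refine (RingQuot.liftAlgHom_mkAlgHom_apply K _ _ _).trans ?_
  simp [fx]

theorem rep_y (hE : ∀ j, (E j : K) ≠ 1) (hB : ∀ j k, (B j k : K) * B k j = 1)
    (hB' : ∀ j, B j j = 1) (j : Fin n) : rep hE hB hB' (y E B j) = opY B j := by
  refine (RingQuot.liftAlgHom_mkAlgHom_apply K _ _ _).trans ?_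
  simp [fy]

end Rep

/-! ### Leading terms in the representation -/

section LeadingRep

variable {K : Type*} [Field K] {n : ℕ}

/-- The weight `∑ i, (i + 1) c_i` of a monomial `t ^ c`. -/
noncomputable def monoWeight : (Fin n →₀ ℕ) →+ ℕ := Finsupp.weight fun i : Fin n => (i : ℕ) + 1

/-- The basis vector `t ^ c e_p`. -/
noncomputable def repBasis (K : Type*) [Field K] {n : ℕ} (i : (Fin n → ℤ) × (Fin n →₀ ℕ)) :
    (Fin n → ℤ) →₀ MvPolynomial (Fin n) K :=
  Finsupp.single i.1 (MvPolynomial.monomial i.2 1)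

theorem linearIndependent_repBasis : LinearIndependent K (repBasis K (n := n)) := by
  have h := (Finsupp.basis fun _ : Fin n → ℤ =>
    MvPolynomial.basisMonomials (Fin n) K).linearIndependent
  have h' := h.comp (fun i : (Fin n → ℤ) × (Fin n →₀ ℕ) => ⟨i.1, i.2⟩) (by
    rintro ⟨a, b⟩ ⟨a', b'⟩ h
    simpa using h)
  have he : (Finsupp.basis fun _ : Fin n → ℤ => MvPolynomial.basisMonomials (Fin n) K) ∘
      (fun i : (Fin n → ℤ) × (Fin n →₀ ℕ) => (⟨i.1, i.2⟩ : Σ _ : Fin n → ℤ, Fin n →₀ ℕ)) =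
      repBasis K := by
    funext i
    simp [repBasis, Finsupp.coe_basis]
  exact he ▸ h'

/-- The span of the basis vectors of weight less than `k`. -/
noncomputable def repFilt (K : Type*) [Field K] {n : ℕ} (k : ℕ) :
    Submodule K ((Fin n → ℤ) →₀ MvPolynomial (Fin n) K) :=
  Submodule.span K (repBasis K '' {i | monoWeight i.2 < k})

theorem repBasis_mem_repFilt {i : (Fin n → ℤ) × (Fin n →₀ ℕ)} {k : ℕ} (h : monoWeight i.2 < k) :
    repBasis K i ∈ repFilt K k :=
  Submodule.subset_span ⟨i, h, rfl⟩

theorem exists_tvar_eq (i : Fin (n + 1)) :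
    ∃ δ, tvar K i = MvPolynomial.monomial δ 1 ∧ monoWeight δ = (i : ℕ) := by
  induction i using Fin.cases with
  | zero => exact ⟨0, by simp [tvar], by simp⟩
  | succ i =>
    exact ⟨Finsupp.single i 1, by simp [tvar, MvPolynomial.X],
      by simp [monoWeight, Finsupp.weight_single]⟩

theorem opY_repBasis (B : Fin n → Fin n → Kˣ) (j : Fin n) (i : (Fin n → ℤ) × (Fin n →₀ ℕ)) :
    opY B j (repBasis K i) = (charY B j i.1 : K) • repBasis K (i.1 + Pi.single j 1, i.2) := by
  rw [opY, repBasis, shift_single, repBasis, Finsupp.smul_single, smul_mul_assoc, one_mul]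

/-- The operator multiplies by a combination of two successive variables of `tvar`. The later one
has weight `j + 1` and the earlier one weight `j`, so the later one leads. -/
theorem opX_repBasis (E : Fin n → Kˣ) (B : Fin n → Fin n → Kˣ) (hE : ∀ j, (E j : K) ≠ 1)
    (j : Fin n) (i : (Fin n → ℤ) × (Fin n →₀ ℕ)) :
    ∃ u : K, u ≠ 0 ∧ opX E B j (repBasis K i) -
      u • repBasis K (i.1 - Pi.single j 1, i.2 + Finsupp.single j 1) ∈
        repFilt K (monoWeight i.2 + (j + 1)) := by
  obtain ⟨δ, hδ, hw⟩ := exists_tvar_eq (K := K) j.castSucc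
  set s : K := (charY B j i.1 : K)⁻¹ * ((E j : K) - 1)⁻¹ with hs
  have hs0 : s ≠ 0 := mul_ne_zero (inv_ne_zero (Units.ne_zero _))
    (inv_ne_zero (sub_ne_zero.2 (hE j)))
  refine ⟨s * charZ E j.succ i.1, mul_ne_zero hs0 (Units.ne_zero _), ?_⟩
  have h : opX E B j (repBasis K i) -
      (s * charZ E j.succ i.1) • repBasis K (i.1 - Pi.single j 1, i.2 + Finsupp.single j 1) =
      (-(s * charZ E j.castSucc i.1)) • repBasis K (i.1 - Pi.single j 1, i.2 + δ) := by
    have h1 : tvar K j.succ = MvPolynomial.monomial (Finsupp.single j 1) 1 := by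
      simp [tvar, MvPolynomial.X]
    simp only [opX, repBasis, shift_single, Finsupp.smul_single, eigYX, eigZ, h1, hδ,
      ← sub_eq_add_neg, ← Finsupp.single_sub, ← hs]
    congr 1
    have h2 : ∀ c d : Fin n →₀ ℕ, (MvPolynomial.monomial (c + d) (1 : K)) =
        MvPolynomial.monomial d 1 * MvPolynomial.monomial c 1 := fun c d => by
      rw [MvPolynomial.monomial_mul, one_mul, add_comm]
    rw [h2, h2, smul_mul_assoc, sub_mul, smul_mul_assoc, smul_mul_assoc]
    module
  rw [h]
  refine Submodule.smul_mem _ _ (repBasis_mem_repFilt ?_)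
  rw [map_add, hw]
  simp

theorem opY_mem_repFilt (B : Fin n → Fin n → Kˣ) (j : Fin n) {k : ℕ}
    {v : (Fin n → ℤ) →₀ MvPolynomial (Fin n) K} (hv : v ∈ repFilt K k) :
    opY B j v ∈ repFilt K k := by
  induction hv using Submodule.span_induction with
  | mem v hv =>
    obtain ⟨i, hi, rfl⟩ := hv
    rw [opY_repBasis]
    exact Submodule.smul_mem _ _ (repBasis_mem_repFilt hi)
  | zero => simp
  | add v v' _ _ h h' => rw [map_add]; exact add_mem h h'
  | smul r v _ h => rw [map_smul]; exact Submodule.smul_mem _ _ h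

theorem repFilt_mono {k k' : ℕ} (h : k ≤ k') : repFilt K (n := n) k ≤ repFilt K k' :=
  Submodule.span_mono (Set.image_mono fun _ hl => lt_of_lt_of_le hl h)

theorem opX_mem_repFilt (E : Fin n → Kˣ) (B : Fin n → Fin n → Kˣ) (hE : ∀ j, (E j : K) ≠ 1)
    (j : Fin n) {k : ℕ} {v : (Fin n → ℤ) →₀ MvPolynomial (Fin n) K} (hv : v ∈ repFilt K k) :
    opX E B j v ∈ repFilt K (k + (j + 1)) := by
  induction hv using Submodule.span_induction with
  | mem v hv =>
    obtain ⟨i, hi, rfl⟩ := hv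
    replace hi : monoWeight i.2 < k := hi
    obtain ⟨u, -, hu⟩ := opX_repBasis E B hE j i
    have h₁ : u • repBasis K (i.1 - Pi.single j 1, i.2 + Finsupp.single j 1) ∈
        repFilt K (k + (j + 1)) := by
      refine Submodule.smul_mem _ _ (repBasis_mem_repFilt ?_)
      simp only [map_add, monoWeight, Finsupp.weight_single, smul_eq_mul] at *
      omega
    have := add_mem (repFilt_mono (by omega) hu) h₁
    rwa [sub_add_cancel] at this
  | zero => simp
  | add v v' _ _ h h' => rw [map_add]; exact add_mem h h'
  | smul r v _ h => rw [map_smul]; exact Submodule.smul_mem _ _ h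

/-- The index of the leading basis vector of a monomial applied to `e_0`. -/
noncomputable def leadIdx (s : Multiset (Fin n ⊕ Fin n)) : (Fin n → ℤ) × (Fin n →₀ ℕ) :=
  (fun j => (s.count (Sum.inr j) : ℤ) - s.count (Sum.inl j),
    Finsupp.equivFunOnFinite.symm fun j => s.count (Sum.inl j))

/-- The exponent of `t` records the number of each `x_j`; the position in `ℤ^n` records the
difference with the number of each `y_j`. Together they determine both counts. -/
theorem leadIdx_injective : Function.Injective (leadIdx (n := n)) := by
  intro s t h
  have h1 : ∀ j, s.count (Sum.inl j) = t.count (Sum.inl j) := fun j => by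
    have := DFunLike.congr_fun (congrArg Prod.snd h) j
    simpa [leadIdx] using this
  have h2 : ∀ j, s.count (Sum.inr j) = t.count (Sum.inr j) := fun j => by
    have := congrFun (congrArg Prod.fst h) j
    simp only [leadIdx, h1] at this
    omega
  ext (j | j)
  · exact h1 j
  · exact h2 j

theorem leadIdx_cons_inl (j : Fin n) (s : Multiset (Fin n ⊕ Fin n)) :
    leadIdx (Sum.inl j ::ₘ s) =
      ((leadIdx s).1 - Pi.single j 1, (leadIdx s).2 + Finsupp.single j 1) := by
  refine Prod.ext ?_ ?_
  · funext k
    by_cases h : k = j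
    · subst h; simp [leadIdx]; ring
    · simp [leadIdx, h]
  · ext k
    by_cases h : k = j
    · subst h; simp [leadIdx]
    · simp [leadIdx, h]

theorem leadIdx_cons_inr (j : Fin n) (s : Multiset (Fin n ⊕ Fin n)) :
    leadIdx (Sum.inr j ::ₘ s) = ((leadIdx s).1 + Pi.single j 1, (leadIdx s).2) := by
  refine Prod.ext ?_ ?_
  · funext k
    by_cases h : k = j
    · subst h; simp [leadIdx]; ring
    · simp [leadIdx, h]
  · ext k
    simp [leadIdx]

end LeadingRep

/-! ### The quantized Weyl algebra as a filtered algebra -/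

section Generators

variable {R : Type*} [CommRing R] {n : ℕ}

/-- The generators of the quantized Weyl algebra as one family. -/
noncomputable def gens (E : Fin n → Rˣ) (B : Fin n → Fin n → Rˣ) : Fin n ⊕ Fin n → Weyl E B :=
  Sum.elim (x E B) (y E B)

/-- The weights of the generators. -/
def gensWeight : Fin n ⊕ Fin n → ℕ := Sum.elim (fun j => j + 1) (fun j => j + 1)

@[simp] theorem gens_inl (E : Fin n → Rˣ) (B : Fin n → Fin n → Rˣ) (j : Fin n) :
    gens E B (Sum.inl j) = x E B j := rfl

@[simp] theorem gens_inr (E : Fin n → Rˣ) (B : Fin n → Fin n → Rˣ) (j : Fin n) :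
    gens E B (Sum.inr j) = y E B j := rfl

theorem adjoin_gens (E : Fin n → Rˣ) (B : Fin n → Fin n → Rˣ) :
    Algebra.adjoin R (Set.range (gens E B)) = ⊤ := by
  have h : gens E B = mk E B ∘ FreeAlgebra.ι R := by
    funext i; cases i <;> rfl
  have hs : Function.Surjective (mk E B) := RingQuot.mkAlgHom_surjective R _
  rw [h, Set.range_comp, ← AlgHom.map_adjoin, FreeAlgebra.adjoin_range_ι, Algebra.map_top,
    AlgHom.range_eq_top]
  exact hs

variable (E : Fin n → Rˣ) (B : Fin n → Fin n → Rˣ)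

theorem y_mul_y (j k : Fin n) : y E B j * y E B k = (B j k : R) • (y E B k * y E B j) := by
  simpa only [map_mul, map_smul, mk_fx, mk_fy] using rel_mk (Rel.yy (E := E) (B := B) j k)

theorem x_mul_x {j k : Fin n} (h : j < k) :
    x E B j * x E B k = (E j * B j k : R) • (x E B k * x E B j) := by
  simpa only [map_mul, map_smul, mk_fx, mk_fy] using rel_mk (Rel.xx (E := E) (B := B) j k h)

theorem x_mul_y_of_lt {j k : Fin n} (h : j < k) :
    x E B j * y E B k = (B k j : R) • (y E B k * x E B j) := by
  simpa only [map_mul, map_smul, mk_fx, mk_fy] using rel_mk (Rel.xy_lt (E := E) (B := B) j k h)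

theorem x_mul_y_of_gt {j k : Fin n} (h : k < j) :
    x E B j * y E B k = (E k * B k j : R) • (y E B k * x E B j) := by
  simpa only [map_mul, map_smul, mk_fx, mk_fy] using rel_mk (Rel.xy_gt (E := E) (B := B) j k h)

theorem x_mul_y_self (j : Fin n) :
    x E B j * y E B j - (E j : R) • (y E B j * x E B j) =
      1 + ∑ i ∈ Finset.Iio j, ((E i : R) - 1) • (y E B i * x E B i) := by
  simpa only [map_mul, map_smul, map_sub, map_add, map_sum, map_one, mk_fx, mk_fy] using
    rel_mk (Rel.xy (E := E) (B := B) j)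

/-- The scalars up to which the generators commute modulo lower terms. -/
def chi : Fin n ⊕ Fin n → Fin n ⊕ Fin n → Rˣ
  | Sum.inr j, Sum.inr k => B j k
  | Sum.inl j, Sum.inl k =>
    if j < k then E j * B j k else if k < j then (E k * B k j)⁻¹ else 1
  | Sum.inl j, Sum.inr k => B k j * if k ≤ j then E k else 1
  | Sum.inr k, Sum.inl j => (B k j * if k ≤ j then E k else 1)⁻¹

theorem sub_inv_smul_mem {A : Type*} [AddCommGroup A] [Module R A] {M : Submodule R A} {a b : A}
    {u : Rˣ} (h : a - (u : R) • b ∈ M) : b - ((u⁻¹ : Rˣ) : R) • a ∈ M := by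
  have := Submodule.smul_mem M (-((u⁻¹ : Rˣ) : R)) h
  rw [smul_sub, smul_smul, neg_mul, Units.inv_mul] at this
  convert this using 1
  module

variable {E B}

theorem skewCommute_gens (hB' : ∀ j, B j j = 1) :
    SkewCommute (gens E B) gensWeight (chi E B) := by
  have hxy : ∀ j k : Fin n, x E B j * y E B k - ((B k j * if k ≤ j then E k else 1 : Rˣ) : R) •
      (y E B k * x E B j) ∈ filt R (gens E B) gensWeight ((j + 1) + (k + 1)) := by
    intro j k
    rcases lt_trichotomy j k with h | rfl | h
    · rw [if_neg h.not_ge, mul_one, x_mul_y_of_lt _ _ h, sub_self]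
      exact zero_mem _
    · rw [if_pos le_rfl, hB', one_mul, x_mul_y_self]
      refine add_mem (word_mem_filt (l := []) (by simp)) (Submodule.sum_mem _ fun i hi => ?_)
      refine Submodule.smul_mem _ _ ?_
      have hi' : i < j := Finset.mem_Iio.1 hi
      rw [Fin.lt_def] at hi'
      -- This is why the weights grow with the index: the terms `y_i x_i` with `i < j` in the
      -- relation for `x_j y_j` must have weight below `2 (j + 1)`.
      have := word_mem_filt (R := R) (gen := gens E B) (w := gensWeight)
        (l := [Sum.inr i, Sum.inl i]) (k := (j + 1) + (j + 1)) (by simp [gensWeight]; omega)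
      simpa using this
    · rw [if_pos h.le, mul_comm (B k j), Units.val_mul, x_mul_y_of_gt _ _ h, sub_self]
      exact zero_mem _
  rintro (j | j) (k | k)
  · simp only [gens_inl, gensWeight, Sum.elim_inl, chi]
    split_ifs with h h'
    · rw [x_mul_x _ _ h, Units.val_mul, sub_self]
      exact zero_mem _
    · refine sub_inv_smul_mem ?_
      rw [x_mul_x _ _ h', Units.val_mul, sub_self]
      exact zero_mem _
    · obtain rfl : j = k := le_antisymm (not_lt.1 h') (not_lt.1 h)
      simp
  · exact hxy j k
  · have := sub_inv_smul_mem (hxy k j)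
    rw [add_comm] at this
    exact this
  · simp only [gens_inr, chi]
    rw [y_mul_y, sub_self]
    exact zero_mem _

end Generators

/-! ### Independence of the ordered monomials -/

section Independent

theorem linearIndependent_normalWord_field {K : Type*} [Field K] {n : ℕ} {E : Fin n → Kˣ}
    {B : Fin n → Fin n → Kˣ} (hE : ∀ j, (E j : K) ≠ 1) (hB : ∀ j k, (B j k : K) * B k j = 1)
    (hB' : ∀ j, B j j = 1) : LinearIndependent K (normalWord (gens E B)) := by
  have key : ∀ l : List (Fin n ⊕ Fin n), ∃ u : K, u ≠ 0 ∧
      rep hE hB hB' (word (gens E B) l) (Finsupp.single 0 1) - u • repBasis K (leadIdx l) ∈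
        repFilt K (monoWeight (leadIdx (l : Multiset (Fin n ⊕ Fin n))).2) := by
    intro l
    induction l with
    | nil =>
      refine ⟨1, one_ne_zero, ?_⟩
      have h0 : leadIdx ((([] : List (Fin n ⊕ Fin n)) : Multiset (Fin n ⊕ Fin n))) =
          (0, 0) := by
        refine Prod.ext ?_ ?_
        · funext j; simp [leadIdx]
        · ext j; simp [leadIdx]
      rw [h0]
      simp [repBasis]
    | cons i l ih =>
      obtain ⟨u, hu, hmem⟩ := ih
      rw [word_cons, map_mul, Module.End.mul_apply, ← Multiset.cons_coe]
      rcases i with j | j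
      · have h₁ := opX_mem_repFilt E B hE j hmem
        obtain ⟨v, hv, hvm⟩ := opX_repBasis E B hE j (leadIdx l)
        refine ⟨u * v, mul_ne_zero hu hv, ?_⟩
        have h₂ := add_mem h₁ (Submodule.smul_mem _ u hvm)
        rw [leadIdx_cons_inl]
        rw [gens_inl, rep_x]
        rw [map_sub, map_smul, smul_sub, smul_smul, sub_add_sub_cancel] at h₂
        simpa [monoWeight, Finsupp.weight_single] using h₂
      · have h₁ := opY_mem_repFilt B j hmem
        refine ⟨u * charY B j (leadIdx l).1, mul_ne_zero hu (Units.ne_zero _), ?_⟩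
        rw [leadIdx_cons_inr]
        rw [gens_inr, rep_y]
        rwa [map_sub, map_smul, opY_repBasis, smul_smul] at h₁
  choose u hu hmem using key
  have hli := linearIndependent_of_triangular (linearIndependent_repBasis (K := K) (n := n))
    (fun i => monoWeight i.2)
    (v := fun s : Multiset (Fin n ⊕ Fin n) =>
      rep hE hB hB' (normalWord (gens E B) s) (Finsupp.single 0 1))
    leadIdx_injective (u := fun s => u s.toList) (fun s => hu _) (fun s => by
      have := hmem s.toList
      rwa [Multiset.coe_toList] at this)
  -- Independence is pulled back along the linear map that applies an algebra element to the vector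
  -- `e_0`.
  exact LinearIndependent.of_comp
    ((LinearMap.applyₗ (Finsupp.single 0 1)).comp (rep hE hB hB').toLinearMap) hli

theorem baseChange_word {R S : Type*} [CommRing R] [CommRing S] {n : ℕ} (φ : R →+* S)
    {E : Fin n → Rˣ} {B : Fin n → Fin n → Rˣ} {E' : Fin n → Sˣ} {B' : Fin n → Fin n → Sˣ}
    (hE : ∀ j, φ (E j) = E' j) (hB : ∀ j k, φ (B j k) = B' j k) (l : List (Fin n ⊕ Fin n)) :
    baseChange φ hE hB (word (gens E B) l) = word (gens E' B') l := by
  induction l with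
  | nil => simp
  | cons i l ih =>
    rw [word_cons, word_cons, map_mul, ih]
    rcases i with j | j
    · simp [baseChange_x]
    · simp [baseChange_y]

theorem baseChange_smul {R S : Type*} [CommRing R] [CommRing S] {n : ℕ} (φ : R →+* S)
    {E : Fin n → Rˣ} {B : Fin n → Fin n → Rˣ} {E' : Fin n → Sˣ} {B' : Fin n → Fin n → Sˣ}
    (hE : ∀ j, φ (E j) = E' j) (hB : ∀ j k, φ (B j k) = B' j k) (r : R) (a : Weyl E B) :
    baseChange φ hE hB (r • a) = φ r • baseChange φ hE hB a := by
  rw [Algebra.smul_def, map_mul, baseChange_algebraMap, Algebra.smul_def]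

/-- The representation divides by `ε_j - 1`, so a relation is first transported to the algebra over
the fraction field; monomials go to monomials and scalars embed. -/
theorem linearIndependent_normalWord {R : Type*} [CommRing R] [IsDomain R] {n : ℕ}
    {E : Fin n → Rˣ} {B : Fin n → Fin n → Rˣ} (hE : ∀ j, E j ≠ 1)
    (hB : ∀ j k, B j k * B k j = 1) (hB' : ∀ j, B j j = 1) :
    LinearIndependent R (normalWord (gens E B)) := by
  set φ := algebraMap R (FractionRing R) with hφ
  have hinj : Function.Injective φ := IsFractionRing.injective R _
  have hli := linearIndependent_normalWord_field (E := fun j => Units.map (φ : R →* FractionRing R) (E j))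
    (B := fun j k => Units.map (φ : R →* FractionRing R) (B j k))
    (fun j h => hE j (Units.ext (hinj (by simpa using h))))
    (fun j k => by
      rw [← Units.val_mul, ← map_mul, hB, map_one, Units.val_one])
    (fun j => by rw [hB', map_one])
  rw [linearIndependent_iff'] at hli ⊢
  intro s g hg i hi
  refine hinj ((hli s (fun i => φ (g i)) ?_ i hi).trans (map_zero φ).symm)
  have hφE : ∀ j, φ (E j) = ((Units.map (φ : R →* FractionRing R) (E j) : _ˣ) : FractionRing R) :=
    fun _ => rfl
  have hφB : ∀ j k, φ (B j k) =
      ((Units.map (φ : R →* FractionRing R) (B j k) : _ˣ) : FractionRing R) := fun _ _ => rfl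
  have := congrArg (baseChange φ hφE hφB) hg
  rw [map_sum, map_zero] at this
  rw [← this]
  refine Finset.sum_congr rfl fun i _ => ?_
  rw [baseChange_smul, normalWord, normalWord, baseChange_word]

/-- The Poincaré–Birkhoff–Witt basis of the quantized Weyl algebra. -/
noncomputable def pbwBasis {R : Type*} [CommRing R] [IsDomain R] {n : ℕ}
    {E : Fin n → Rˣ} {B : Fin n → Fin n → Rˣ} (hE : ∀ j, E j ≠ 1)
    (hB : ∀ j k, B j k * B k j = 1) (hB' : ∀ j, B j j = 1) :
    Module.Basis (Multiset (Fin n ⊕ Fin n)) R (Weyl E B) :=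
  Module.Basis.mk (linearIndependent_normalWord hE hB hB')
    ((skewCommute_gens hB').span_normalWord (adjoin_gens E B)).ge

end Independent

/-! ### Commutation up to a scalar -/

section QCommute

variable {R A : Type*} [CommRing R] [Ring A] [Algebra R A]

/-- `a` and `b` commute up to the scalar `r`. -/
def QCommute (r : Rˣ) (a b : A) : Prop := a * b = (r : R) • (b * a)

theorem QCommute.symm {r : Rˣ} {a b : A} (h : QCommute r a b) : QCommute r⁻¹ b a := by
  unfold QCommute at *
  rw [h, smul_smul, Units.inv_mul, one_smul]

theorem QCommute.mul_left {r s : Rˣ} {a b c : A} (h₁ : QCommute r a c) (h₂ : QCommute s b c) :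
    QCommute (r * s) (a * b) c := by
  unfold QCommute at *
  rw [mul_assoc, h₂, mul_smul_comm, ← mul_assoc, h₁, smul_mul_assoc, smul_smul, Units.val_mul,
    mul_assoc, mul_comm (s : R)]

theorem QCommute.mul_right {r s : Rˣ} {a b c : A} (h₁ : QCommute r a b) (h₂ : QCommute s a c) :
    QCommute (r * s) a (b * c) := by
  unfold QCommute at *
  rw [← mul_assoc, h₁, smul_mul_assoc, mul_assoc, h₂, mul_smul_comm, smul_smul, Units.val_mul,
    mul_assoc]

theorem QCommute.add_left {r : Rˣ} {a b c : A} (h₁ : QCommute r a c) (h₂ : QCommute r b c) :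
    QCommute r (a + b) c := by
  unfold QCommute at *
  rw [add_mul, h₁, h₂, mul_add, smul_add]

theorem QCommute.smul_left {r : Rˣ} {a b : A} (h : QCommute r a b) (t : R) :
    QCommute r (t • a) b := by
  unfold QCommute at *
  rw [smul_mul_assoc, h, mul_smul_comm, smul_comm]

theorem qCommute_one_iff {a b : A} : QCommute (1 : Rˣ) a b ↔ Commute a b := by
  rw [QCommute, Units.val_one, one_smul]; rfl

theorem QCommute.pow_left {r : Rˣ} {a b : A} (h : QCommute r a b) (k : ℕ) :
    QCommute (r ^ k) (a ^ k) b := by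
  induction k with
  | zero => rw [pow_zero, pow_zero, qCommute_one_iff]; exact Commute.one_left b
  | succ k ih => rw [pow_succ, pow_succ]; exact ih.mul_left h

theorem QCommute.pow_right {r : Rˣ} {a b : A} (h : QCommute r a b) (k : ℕ) :
    QCommute (r ^ k) a (b ^ k) := by
  have := (h.symm.pow_left k).symm
  rwa [inv_pow, inv_inv] at this

theorem QCommute.pow_pow {r : Rˣ} {a b : A} (h : QCommute r a b) (k l : ℕ) :
    QCommute (r ^ (k * l)) (a ^ k) (b ^ l) := by
  rw [pow_mul]
  exact (h.pow_left k).pow_right l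

end QCommute

/-! ### The normal elements `z_0 = 1, z_1, …, z_n` -/

section NormalElements

variable {R : Type*} [CommRing R] {n : ℕ} (E : Fin n → Rˣ) (B : Fin n → Fin n → Rˣ)

/-- The sequence `z_0 = 1, z_1, …, z_n` of normal elements. -/
noncomputable def zz (i : Fin (n + 1)) : Weyl E B :=
  1 + ∑ k with Fin.castSucc k < i, ((E k : R) - 1) • (y E B k * x E B k)

theorem zz_zero : zz E B 0 = 1 := by simp [zz]

theorem zz_castSucc (j : Fin n) :
    zz E B j.castSucc = 1 + ∑ i ∈ Finset.Iio j, ((E i : R) - 1) • (y E B i * x E B i) := by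
  rw [zz]
  congr 1
  refine Finset.sum_congr ?_ fun _ _ => rfl
  ext k
  simp

theorem z_eq_zz (j : Fin n) : z E B j = zz E B j.succ := by
  rw [z, zz]
  congr 1
  refine Finset.sum_congr ?_ fun _ _ => rfl
  ext k
  simp [Fin.castSucc_lt_succ_iff]

theorem zz_succ (j : Fin n) :
    zz E B j.succ = zz E B j.castSucc + ((E j : R) - 1) • (y E B j * x E B j) := by
  have hs : Finset.univ.filter (fun k : Fin n => k.castSucc < j.succ) =
      insert j (Finset.univ.filter fun k : Fin n => k.castSucc < j.castSucc) := by
    ext k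
    simp [Fin.castSucc_lt_succ_iff, le_iff_eq_or_lt]
  rw [zz, hs, Finset.sum_insert (by simp), zz]
  abel

theorem x_mul_y_eq (j : Fin n) :
    x E B j * y E B j = (E j : R) • (y E B j * x E B j) + zz E B j.castSucc := by
  rw [zz_castSucc, ← x_mul_y_self, add_sub_cancel]

variable {E B}

theorem qCommute_yx_x_of_lt {l k : Fin n} (h : l < k) :
    QCommute (1 : Rˣ) (y E B l * x E B l) (x E B k) := by
  have h₁ : QCommute (E l * B l k) (x E B l) (x E B k) := by
    rw [QCommute, x_mul_x _ _ h, Units.val_mul]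
  have h₂ : QCommute (E l * B l k) (x E B k) (y E B l) := by
    rw [QCommute, x_mul_y_of_gt _ _ h, Units.val_mul]
  simpa using h₂.symm.mul_left h₁

theorem qCommute_yx_y_of_lt {l k : Fin n} (hB : ∀ j k, B j k * B k j = 1) (h : l < k) :
    QCommute (1 : Rˣ) (y E B l * x E B l) (y E B k) := by
  have h₁ : QCommute (B k l) (x E B l) (y E B k) := by
    rw [QCommute, x_mul_y_of_lt _ _ h]
  have h₂ : QCommute (B l k) (y E B l) (y E B k) := y_mul_y _ _ _ _
  simpa [hB] using h₂.mul_left h₁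

theorem qCommute_yx_x_of_gt {l k : Fin n} (hB : ∀ j k, B j k * B k j = 1) (h : k < l) :
    QCommute (E k)⁻¹ (y E B l * x E B l) (x E B k) := by
  have h₁ : QCommute (E k * B k l) (x E B k) (x E B l) := by
    rw [QCommute, x_mul_x _ _ h, Units.val_mul]
  have h₂ : QCommute (B l k) (x E B k) (y E B l) := by
    rw [QCommute, x_mul_y_of_lt _ _ h]
  have := h₂.symm.mul_left h₁.symm
  rwa [← mul_inv, mul_left_comm, hB, mul_one] at this

theorem qCommute_yx_y_of_gt {l k : Fin n} (hB : ∀ j k, B j k * B k j = 1) (h : k < l) :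
    QCommute (E k) (y E B l * x E B l) (y E B k) := by
  have h₁ : QCommute (E k * B k l) (x E B l) (y E B k) := by
    rw [QCommute, x_mul_y_of_gt _ _ h, Units.val_mul]
  have h₂ : QCommute (B l k) (y E B l) (y E B k) := y_mul_y _ _ _ _
  have := h₂.mul_left h₁
  rwa [mul_left_comm, hB, mul_one] at this

theorem commute_zz_x_y (hB : ∀ j k, B j k * B k j = 1) {i : Fin (n + 1)} {k : Fin n}
    (h : i ≤ k.castSucc) : Commute (zz E B i) (x E B k) ∧ Commute (zz E B i) (y E B k) := by
  induction i using Fin.induction with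
  | zero => rw [zz_zero]; exact ⟨Commute.one_left _, Commute.one_left _⟩
  | succ i ih =>
    have hik : i < k := by simpa [Fin.succ_le_castSucc_iff] using h
    obtain ⟨hx, hy⟩ := ih (by simpa using hik.le)
    rw [zz_succ]
    simp only [← qCommute_one_iff (R := R)] at *
    exact ⟨hx.add_left ((qCommute_yx_x_of_lt hik).smul_left _),
      hy.add_left ((qCommute_yx_y_of_lt hB hik).smul_left _)⟩

/-- Induction on `i`: each later summand `y_l x_l` with `l > k` has the same scalars with `x_k` and
`y_k`, so only the step that adds `y_k x_k` itself needs the inhomogeneous relation. -/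
theorem qCommute_zz_x_y (hB : ∀ j k, B j k * B k j = 1) {i : Fin (n + 1)} {k : Fin n}
    (h : k.castSucc < i) :
    QCommute (E k)⁻¹ (zz E B i) (x E B k) ∧ QCommute (E k) (zz E B i) (y E B k) := by
  induction i using Fin.induction with
  | zero => simp at h
  | succ i ih =>
    rw [zz_succ]
    rcases (Fin.castSucc_lt_succ_iff.1 h).lt_or_eq with h | rfl
    · obtain ⟨hx, hy⟩ := ih (by simpa using h)
      exact ⟨hx.add_left ((qCommute_yx_x_of_gt hB h).smul_left _),
        hy.add_left ((qCommute_yx_y_of_gt hB h).smul_left _)⟩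
    -- At `l = k` the summand does not commute up to a scalar by itself. The extra `z_{k-1}` from
    -- `x_k y_k = ε_k y_k x_k + z_{k-1}` combines with the first summand of `z_k = z_{k-1} + (ε_k -
    -- 1) y_k x_k`.
    · obtain ⟨hx, hy⟩ := commute_zz_x_y (E := E) hB (le_refl k.castSucc)
      have hxy := x_mul_y_eq E B k
      constructor
      · have : QCommute (E k) (x E B k) (zz E B k.castSucc + ((E k : R) - 1) •
            (y E B k * x E B k)) := by
          rw [QCommute, mul_add, add_mul, mul_smul_comm, ← mul_assoc, hxy, smul_mul_assoc,
            add_mul, smul_mul_assoc, ← hx.eq]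
          module
        exact this.symm
      · rw [QCommute, mul_add, add_mul, smul_mul_assoc, mul_assoc, hxy, mul_smul_comm,
          mul_add, mul_smul_comm, hy.eq]
        module

theorem commute_zz_yx (hB : ∀ j k, B j k * B k j = 1) (i : Fin (n + 1)) (k : Fin n) :
    Commute (zz E B i) (y E B k * x E B k) := by
  by_cases h : k.castSucc < i
  · obtain ⟨hx, hy⟩ := qCommute_zz_x_y (E := E) hB h
    rw [← qCommute_one_iff (R := R)]
    simpa using hy.mul_right hx
  · obtain ⟨hx, hy⟩ := commute_zz_x_y (E := E) hB (not_lt.1 h)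
    exact hy.mul_right hx

theorem commute_zz_zz (hB : ∀ j k, B j k * B k j = 1) (i j : Fin (n + 1)) :
    Commute (zz E B i) (zz E B j) := by
  conv => arg 2; rw [zz]
  exact (Commute.one_right _).add_right
    (Commute.sum_right _ _ _ fun k _ => (commute_zz_yx hB i k).smul_right _)

theorem qCommute_zz_x (hB : ∀ j k, B j k * B k j = 1) (i : Fin (n + 1)) (k : Fin n) :
    QCommute (if k.castSucc < i then (E k)⁻¹ else 1) (zz E B i) (x E B k) := by
  split_ifs with h
  · exact (qCommute_zz_x_y hB h).1
  · exact qCommute_one_iff.2 (commute_zz_x_y hB (not_lt.1 h)).1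

theorem qCommute_zz_y (hB : ∀ j k, B j k * B k j = 1) (i : Fin (n + 1)) (k : Fin n) :
    QCommute (if k.castSucc < i then E k else 1) (zz E B i) (y E B k) := by
  split_ifs with h
  · exact (qCommute_zz_x_y hB h).2
  · exact qCommute_one_iff.2 (commute_zz_x_y hB (not_lt.1 h)).2

end NormalElements

/-! ### Factorization over roots of unity -/

section PowerIdentity

open Polynomial

variable {T : Type*} [CommRing T] [IsDomain T] {n : ℕ} {E : Fin n → Tˣ} {B : Fin n → Fin n → Tˣ}

/-- Peeling off the innermost `y_j x_j`, with `(1 - ε_j) y_j x_j = z_{j-1} - z_j`, and moving it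
left past the remaining `y_j` gives the factors `z_{j-1} - ε_j^{-i} z_j`. For a primitive `d`-th
root their product over `i < d` is `z_{j-1}^d - z_j^d`. -/
theorem smul_y_pow_mul_x_pow (hB : ∀ j k, B j k * B k j = 1) (j : Fin n) {d : ℕ} (hd : 0 < d)
    (hζ : IsPrimitiveRoot (E j : T) d) :
    (1 - (E j : T)) ^ d • (y E B j ^ d * x E B j ^ d) =
      zz E B j.castSucc ^ d - zz E B j.succ ^ d := by
  set ζ : T := (((E j)⁻¹ : Tˣ) : T)
  have hcom : ∀ p : T[X], Commute (aeval (zz E B j.succ) p) (zz E B j.castSucc) := by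
    intro p
    induction p using Polynomial.induction_on' with
    | add p q hp hq => rw [map_add]; exact hp.add_left hq
    | monomial k a =>
      rw [aeval_monomial]
      exact (Algebra.commute_algebraMap_left _ _).mul_left ((commute_zz_zz hB _ _).pow_left _)
  -- The algebra is noncommutative, but `z_{j-1}` and `z_j` commute, so the factorization is proved
  -- in `T[X][X]` and substituted: the outer variable goes to `z_{j-1}`, the inner one to `z_j`.
  set ψ : T[X][X] →+* Weyl E B :=
    eval₂RingHom' (aeval (zz E B j.succ) : T[X] →ₐ[T] Weyl E B).toRingHom
      (zz E B j.castSucc) hcom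
  have hψX : ψ X = zz E B j.castSucc := eval₂_X _ _
  have hψC : ∀ p, ψ (C p) = aeval (zz E B j.succ) p := fun p => eval₂_C _ _
  have key : ∀ k, (1 - (E j : T)) ^ k • (y E B j ^ k * x E B j ^ k) =
      ψ (∏ i ∈ Finset.range k, (X - C (C ζ ^ i * X))) := by
    intro k
    induction k with
    | zero => simp
    | succ k ih =>
      rw [Finset.prod_range_succ_comm, map_mul, ← ih, map_sub, hψX, hψC]
      have hzy := ((qCommute_zz_x_y (E := E) hB (Fin.castSucc_lt_succ (i := j))).2.pow_right k).symm
      have hwy := (commute_zz_x_y (E := E) hB (le_refl j.castSucc)).2.pow_right k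
      have h1 : (1 - (E j : T)) • (y E B j * x E B j) = zz E B j.castSucc - zz E B j.succ := by
        rw [zz_succ]; module
      have h2 : y E B j ^ k * zz E B j.succ = ζ ^ k • (zz E B j.succ * y E B j ^ k) := by
        rw [QCommute, ← inv_pow, Units.val_pow_eq_pow_val] at hzy
        exact hzy
      have h3 : y E B j ^ (k + 1) * x E B j ^ (k + 1) =
          y E B j ^ k * (y E B j * x E B j) * x E B j ^ k := by
        rw [pow_succ, pow_succ']; simp only [mul_assoc]
      have h4 : aeval (zz E B j.succ) (C ζ ^ k * X : T[X]) = ζ ^ k • zz E B j.succ := by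
        rw [← C_pow, map_mul, aeval_C, aeval_X, Algebra.smul_def]
      have h5 : (1 - (E j : T)) • (y E B j ^ k * (y E B j * x E B j)) =
          (zz E B j.castSucc - ζ ^ k • zz E B j.succ) * y E B j ^ k := by
        rw [← mul_smul_comm, h1, mul_sub, h2, ← hwy.eq, sub_mul, smul_mul_assoc]
      rw [h3, pow_succ, mul_smul, ← smul_mul_assoc, h5, h4, mul_assoc, mul_smul_comm]
  have hprim : IsPrimitiveRoot (C ζ : T[X]) d := by
    refine IsPrimitiveRoot.map_of_injective ?_ C_injective
    have := (IsPrimitiveRoot.coe_units_iff.1 hζ).inv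
    exact IsPrimitiveRoot.coe_units_iff.2 this
  rw [key, ← X_pow_sub_C_eq_prod hprim hd rfl, map_sub, map_pow, hψX, hψC, map_pow, aeval_X]

end PowerIdentity

/-- The index of the pair to which a generator belongs. -/
def pairIdx {n : ℕ} : Fin n ⊕ Fin n → Fin n := Sum.elim id id

/-! ### Centrality tested on generators -/

section Generic

variable {R : Type*} [CommRing R] {n : ℕ} {E : Fin n → Rˣ} {B : Fin n → Fin n → Rˣ}

theorem mem_center_of_commute_gens {a : Weyl E B} (h : ∀ g, Commute (gens E B g) a) :
    a ∈ Subalgebra.center R (Weyl E B) := by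
  rw [Subalgebra.mem_center_iff]
  intro b
  have hb : b ∈ Algebra.adjoin R (Set.range (gens E B)) := adjoin_gens E B ▸ Algebra.mem_top
  induction hb using Algebra.adjoin_induction with
  | mem b hb => obtain ⟨g, rfl⟩ := hb; exact h g
  | algebraMap r => exact Algebra.commutes r a
  | add b c _ _ hb hc => rw [add_mul, mul_add, hb, hc]
  | mul b c _ _ hb hc => rw [mul_assoc, hc, ← mul_assoc, hb, mul_assoc]

theorem qCommute_gens (g h : Fin n ⊕ Fin n)
    (hgh : pairIdx g = pairIdx h → g = h) :
    QCommute (chi E B g h) (gens E B g) (gens E B h) := by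
  have hxy : ∀ j k : Fin n, j ≠ k →
      QCommute (B k j * if k ≤ j then E k else 1) (x E B j) (y E B k) := by
    intro j k hjk
    rcases hjk.lt_or_gt with h | h
    · rw [if_neg h.not_ge, mul_one, QCommute, x_mul_y_of_lt _ _ h]
    · rw [if_pos h.le, QCommute, mul_comm, Units.val_mul, x_mul_y_of_gt _ _ h]
  rcases g with j | j <;> rcases h with k | k
  · simp only [gens_inl, chi]
    split_ifs with h h'
    · rw [QCommute, x_mul_x _ _ h, Units.val_mul]
    · refine QCommute.symm ?_
      rw [QCommute, x_mul_x _ _ h', Units.val_mul]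
    · obtain rfl : j = k := le_antisymm (not_lt.1 h') (not_lt.1 h)
      exact qCommute_one_iff.2 (Commute.refl _)
  · exact hxy j k fun h => by simpa using hgh h
  · exact (hxy k j fun h => by simpa using hgh h.symm).symm
  · exact y_mul_y _ _ _ _

end Generic

/-! ### The center at roots of unity -/

section RootOfUnity

variable {T : Type*} [CommRing T] {n : ℕ}

/-- Parameters that are roots of unity, with the orders of the `ε_j` forming a divisibility
chain. -/
structure RootParams (E : Fin n → Tˣ) (B : Fin n → Fin n → Tˣ) (d : Fin n → ℕ) : Prop where
  ne_one : ∀ j, E j ≠ 1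
  skew : ∀ j k, B j k * B k j = 1
  diag : ∀ j, B j j = 1
  pos : ∀ j, 0 < d j
  prim : ∀ j, IsPrimitiveRoot (E j) (d j)
  pow : ∀ j k, B j k ^ d j = 1
  dvd : ∀ j l, j ≤ l → d j ∣ d l

variable {E : Fin n → Tˣ} {B : Fin n → Fin n → Tˣ} {d : Fin n → ℕ}

namespace RootParams

theorem pow' (H : RootParams E B d) (j k : Fin n) : B j k ^ d k = 1 := by
  rw [eq_inv_of_mul_eq_one_left (H.skew j k), inv_pow, H.pow, inv_one]

theorem E_pow (H : RootParams E B d) {j k : Fin n} (h : j ≤ k) : E j ^ d k = 1 :=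
  (H.prim j).pow_eq_one_iff_dvd _ |>.2 (H.dvd j k h)

theorem chi_pow (H : RootParams E B d) (g h : Fin n ⊕ Fin n) : chi E B g h ^ d (pairIdx g) = 1 := by
  rcases g with j | j <;> rcases h with k | k <;> simp only [chi, pairIdx, Sum.elim_inl,
    Sum.elim_inr, id]
  · split_ifs with h h'
    · rw [mul_pow, H.E_pow le_rfl, H.pow, one_mul]
    · rw [inv_pow, mul_pow, H.E_pow h'.le, H.pow', one_mul, inv_one]
    · exact one_pow _
  · split_ifs with h
    · rw [mul_pow, H.E_pow h, H.pow', one_mul]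
    · rw [mul_one, H.pow']
  · split_ifs with h
    · rw [inv_pow, mul_pow, H.E_pow le_rfl, H.pow, one_mul, inv_one]
    · rw [mul_one, inv_pow, H.pow, inv_one]
  · exact H.pow j k

/-- Combining the conditions for `x_k` and `y_k` removes all `β`'s and gives `d_k ∣ b_k - a_k`,
where `a` and `b` count the `y`'s and `x`'s. This removes the `β`'s from the condition for `y_k`
alone, leaving a divisibility of `∑_{j ≥ k} b_j` that the chain `d_k ∣ d_j` resolves from the top
index downwards. -/
theorem dvd_of_forall_prod_eq_one (H : RootParams E B d) {s : Multiset (Fin n ⊕ Fin n)}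
    (hs : ∀ g, (s.map fun h => chi E B h g).prod = 1) (g : Fin n ⊕ Fin n) :
    d (pairIdx g) ∣ s.count g := by
  set a : Fin n → ℕ := fun j => s.count (Sum.inr j) with ha
  set b : Fin n → ℕ := fun j => s.count (Sum.inl j) with hb
  have hs' : ∀ g, (∏ j, chi E B (Sum.inl j) g ^ b j) * ∏ j, chi E B (Sum.inr j) g ^ a j = 1 := by
    intro g
    rw [← hs g, Finset.prod_multiset_map_count, ← Fintype.prod_sum_type
      (f := fun h => chi E B h g ^ s.count h)]
    exact (Finset.prod_subset (Finset.subset_univ _) fun h _ hh => by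
      rw [Multiset.mem_toFinset] at hh
      rw [Multiset.count_eq_zero_of_notMem hh, pow_zero]).symm
  clear_value a b
  have hBinv : ∀ j k, B j k = (B k j)⁻¹ := fun j k => eq_inv_of_mul_eq_one_left (H.skew j k)
  -- Against the product `x_k y_k` the scalars of `x_j` and `y_j` are `ε_j` and its inverse for `j ≤
  -- k`, and trivial for `j > k`.
  have hpair : ∀ k, ∏ j, (if j ≤ k then E j ^ ((b j : ℤ) - a j) else 1) = 1 := by
    intro k
    have h := congrArg₂ (· * ·) (hs' (Sum.inl k)) (hs' (Sum.inr k))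
    simp only [← Finset.prod_mul_distrib, mul_one] at h
    refine Eq.trans (Finset.prod_congr rfl fun j _ => ?_) h
    simp only [chi]
    rcases lt_trichotomy j k with hjk | rfl | hjk
    · simp only [hjk, hjk.le, hjk.not_ge, if_true, if_false, hBinv k j, zpow_sub, zpow_natCast,
        mul_pow, inv_pow, mul_inv, mul_one]
      generalize E j ^ b j = p, E j ^ a j = q, B j k ^ b j = r, B j k ^ a j = t
      calc p * q⁻¹ = p * q⁻¹ * (r * r⁻¹) * (t * t⁻¹) := by simp
        _ = _ := by ac_rfl
    · simp only [le_refl, if_true, lt_irrefl, if_false, H.diag, one_mul, one_pow, zpow_sub,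
        zpow_natCast, inv_pow, mul_one]
      rw [mul_comm]
    · simp only [hjk, hjk.le, hjk.not_ge, hjk.not_gt, if_true, if_false, hBinv k j, mul_pow,
        inv_pow, mul_inv, mul_one, inv_inv]
      generalize E k ^ b j = p, B j k ^ b j = r, B j k ^ a j = t
      calc 1 = (p * p⁻¹) * (r * r⁻¹) * (t * t⁻¹) := by simp
        _ = _ := by ac_rfl
  have hEab : ∀ k, E k ^ ((b k : ℤ) - a k) = 1 := by
    intro k
    induction k using WellFoundedLT.induction with
    | ind k ih =>
      have := hpair k
      rw [Finset.prod_eq_single k] at this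
      · simpa using this
      · intro j _ hjk
        split_ifs with h
        · exact ih j (lt_of_le_of_ne h hjk)
        · rfl
      · simp
  have hab : ∀ k, (d k : ℤ) ∣ (b k : ℤ) - a k := fun k =>
    ((H.prim k).zpow_eq_one_iff_dvd _).1 (hEab k)
  have hsum : ∀ k, d k ∣ ∑ j with k ≤ j, b j := by
    intro k
    have h := hs' (Sum.inr k)
    simp only [chi, ← Finset.prod_mul_distrib] at h
    refine ((H.prim k).pow_eq_one_iff_dvd _).1 ?_
    rw [← Finset.prod_pow_eq_pow_sum, Finset.prod_filter]
    refine Eq.trans (Finset.prod_congr rfl fun j _ => ?_) h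
    -- The two factors combine to `β_kj ^ (b_j - a_j)`, and the exponent is a multiple of `d_j`,
    -- which kills `β_kj`.
    have hB1 : B k j ^ b j * B j k ^ a j = 1 := by
      obtain ⟨c, hc⟩ := hab j
      rw [hBinv j k, inv_pow, ← zpow_natCast, ← zpow_natCast, ← zpow_neg, ← zpow_add,
        ← sub_eq_add_neg, hc, zpow_mul, zpow_natCast, H.pow', one_zpow]
    rw [mul_pow, mul_right_comm, hB1, one_mul]
    split_ifs <;> simp
  have hdb : ∀ k, d k ∣ b k := by
    intro k
    induction k using WellFoundedGT.induction with
    | ind k ih =>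
      have hk := hsum k
      rw [← Finset.add_sum_erase _ _ (by simp : k ∈ Finset.univ.filter (k ≤ ·))] at hk
      refine (Nat.dvd_add_left (Finset.dvd_sum fun j hj => ?_)).1 hk
      simp only [Finset.mem_erase, Finset.mem_filter, Finset.mem_univ, true_and] at hj
      exact (H.dvd k j hj.2).trans (ih j (lt_of_le_of_ne hj.2 hj.1.symm))
  rcases g with k | k
  · rw [hb] at hdb
    exact hdb k
  · have h1 := dvd_sub (Int.natCast_dvd_natCast.2 (hdb k)) (hab k)
    rw [sub_sub_cancel, ha] at h1
    exact Int.natCast_dvd_natCast.1 h1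

variable [IsDomain T]

theorem smul_right_injective (H : RootParams E B d) {t : T} (ht : t ≠ 0) {a b : Weyl E B} (h : t • a = t • b) :
    a = b := by
  have hb := pbwBasis H.ne_one H.skew H.diag
  refine hb.repr.injective ?_
  ext s
  have := congrArg (fun a => hb.repr a s) h
  simpa [ht] using this

/-- After multiplication by `ε_j - 1`, which is injective by freeness, `x_j y_j` becomes `ε_j z_j -
z_{j-1}`. Moving `x_j^{d_j - 1}` past it turns `ε_j` into `ε_j^{d_j} = 1`, leaving `z_j - z_{j-1} =
(ε_j - 1) y_j x_j`. -/
theorem commute_x_pow_y (H : RootParams E B d) (j : Fin n) : Commute (x E B j ^ d j) (y E B j) := by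
  have hne : (E j : T) - 1 ≠ 0 := sub_ne_zero.2 fun h => H.ne_one j (Units.ext h)
  refine H.smul_right_injective hne ?_
  obtain ⟨k, hk⟩ := Nat.exists_eq_succ_of_ne_zero (H.pos j).ne'
  have hyx : ((E j : T) - 1) • (y E B j * x E B j) = zz E B j.succ - zz E B j.castSucc := by
    rw [zz_succ, add_sub_cancel_left]
  have hxy : ((E j : T) - 1) • (x E B j * y E B j) =
      (E j : T) • zz E B j.succ - zz E B j.castSucc := by
    rw [x_mul_y_eq, zz_succ]; module
  have hz := ((qCommute_zz_x_y (E := E) H.skew (Fin.castSucc_lt_succ (i := j))).1.pow_right k).symm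
  have hw := (commute_zz_x_y (E := E) H.skew (le_refl j.castSucc)).1.pow_right k
  rw [QCommute, inv_pow, inv_inv] at hz
  have hE : (E j : T) * (E j ^ k : Tˣ) = 1 := by
    rw [← Units.val_mul, ← pow_succ', ← Nat.succ_eq_add_one, ← hk, H.E_pow le_rfl, Units.val_one]
  rw [hk, pow_succ, mul_assoc, ← mul_smul_comm, hxy, mul_sub, mul_smul_comm, hz, smul_smul, hE,
    one_smul, ← hw.eq, ← sub_mul, ← hyx, ← pow_succ, pow_succ', smul_mul_assoc, mul_assoc]

theorem commute_x_y_pow (H : RootParams E B d) (j : Fin n) : Commute (x E B j) (y E B j ^ d j) := by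
  have hne : (E j : T) - 1 ≠ 0 := sub_ne_zero.2 fun h => H.ne_one j (Units.ext h)
  refine H.smul_right_injective hne ?_
  obtain ⟨k, hk⟩ := Nat.exists_eq_succ_of_ne_zero (H.pos j).ne'
  have hyx : ((E j : T) - 1) • (y E B j * x E B j) = zz E B j.succ - zz E B j.castSucc := by
    rw [zz_succ, add_sub_cancel_left]
  have hxy : ((E j : T) - 1) • (x E B j * y E B j) =
      (E j : T) • zz E B j.succ - zz E B j.castSucc := by
    rw [x_mul_y_eq, zz_succ]; module
  have hz := (qCommute_zz_x_y (E := E) H.skew (Fin.castSucc_lt_succ (i := j))).2.pow_right k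
  have hw := (commute_zz_x_y (E := E) H.skew (le_refl j.castSucc)).2.pow_right k
  rw [QCommute] at hz
  have hE : (E j : T) * (E j ^ k : Tˣ) = 1 := by
    rw [← Units.val_mul, ← pow_succ', ← Nat.succ_eq_add_one, ← hk, H.E_pow le_rfl, Units.val_one]
  rw [hk, pow_succ', ← mul_assoc, ← smul_mul_assoc, hxy, sub_mul, smul_mul_assoc, hz, smul_smul,
    hE, one_smul, hw.eq, ← mul_sub, ← hyx, ← pow_succ', pow_succ, mul_smul_comm, mul_assoc]

/-- Every pair of generators commutes exactly up to a scalar killed by the `d`-th power, except for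
`x_j` with `y_j`, where the preceding two commutations apply. -/
theorem gens_pow_mem_center (H : RootParams E B d) (g : Fin n ⊕ Fin n) :
    gens E B g ^ d (pairIdx g) ∈ Subalgebra.center T (Weyl E B) := by
  refine mem_center_of_commute_gens fun h => Commute.symm ?_
  by_cases hgh : pairIdx g = pairIdx h → g = h
  · have := (qCommute_gens (E := E) (B := B) g h hgh).pow_left (d (pairIdx g))
    rwa [H.chi_pow, qCommute_one_iff] at this
  · push Not at hgh
    rcases g with j | j <;> rcases h with k | k
    · exact absurd (congrArg Sum.inl hgh.1) hgh.2
    · obtain rfl : j = k := hgh.1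
      exact H.commute_x_pow_y j
    · obtain rfl : j = k := hgh.1
      exact (H.commute_x_y_pow j).symm
    · exact absurd (congrArg Sum.inr hgh.1) hgh.2

/-- The central element `x_j ^ d_j` or `y_j ^ d_j`. -/
noncomputable def centralGen (H : RootParams E B d) (g : Fin n ⊕ Fin n) : Subalgebra.center T (Weyl E B) :=
  ⟨gens E B g ^ d (pairIdx g), H.gens_pow_mem_center g⟩

/-- The exponents of the leading monomial of a monomial in the central generators. -/
def centralLead (d : Fin n → ℕ) (c : Fin n ⊕ Fin n →₀ ℕ) : Multiset (Fin n ⊕ Fin n) :=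
  ∑ g, (c g * d (pairIdx g)) • {g}

theorem count_centralLead (d : Fin n → ℕ) (c : Fin n ⊕ Fin n →₀ ℕ) (g : Fin n ⊕ Fin n) :
    (centralLead d c).count g = c g * d (pairIdx g) := by
  rw [centralLead, Multiset.count_sum', Finset.sum_eq_single g]
  · simp
  · intro h _ hg
    simp [hg.symm]
  · simp

theorem hasLeading_monomial (H : RootParams E B d) (c : Fin n ⊕ Fin n →₀ ℕ) :
    HasLeading (gens E B) gensWeight T (centralLead d c)
      (MvPolynomial.aeval H.centralGen (MvPolynomial.monomial c (1 : T)) : Weyl E B) := by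
  have key : ∀ S : Finset (Fin n ⊕ Fin n), HasLeading (gens E B) gensWeight T
      (∑ g ∈ S, (c g * d (pairIdx g)) • {g})
      ((∏ g ∈ S, H.centralGen g ^ c g : Subalgebra.center T (Weyl E B)) : Weyl E B) := by
    intro S
    induction S using Finset.induction_on with
    | empty => simpa using (skewCommute_gens H.diag).hasLeading_one
    | insert g S hg ih =>
      rw [Finset.sum_insert hg, Finset.prod_insert hg, MulMemClass.coe_mul]
      refine (skewCommute_gens H.diag).hasLeading_mul ?_ ih
      have := (skewCommute_gens H.diag).hasLeading_pow
        ((skewCommute_gens (E := E) H.diag).hasLeading_gen g) (d (pairIdx g) * c g)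
      rw [pow_mul, mul_comm] at this
      exact this
  have := key Finset.univ
  rwa [MvPolynomial.aeval_monomial, map_one, one_mul, Finsupp.prod_fintype _ _ (by simp)]

/-- Distinct monomials in the central generators have distinct leading monomials, because the
exponents are only multiplied by the positive `d_j`. -/
theorem aeval_injective (H : RootParams E B d) : Function.Injective
    (MvPolynomial.aeval H.centralGen :
      MvPolynomial (Fin n ⊕ Fin n) T →ₐ[T] Subalgebra.center T (Weyl E B)) := by
  choose u hu using H.hasLeading_monomial
  have hli := linearIndependent_of_triangular
    (linearIndependent_normalWord H.ne_one H.skew H.diag) (multisetWeight gensWeight)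
    (φ := centralLead d) (u := fun c => (u c : T)) (v := fun c =>
      (MvPolynomial.aeval H.centralGen (MvPolynomial.monomial c (1 : T)) : Weyl E B))
    (fun c c' h => by
      ext g
      have := congrArg (Multiset.count g) h
      rw [count_centralLead, count_centralLead] at this
      exact Nat.eq_of_mul_eq_mul_right (H.pos _) this)
    (fun c => (u c).ne_zero)
    (fun c => by
      rw [← (skewCommute_gens H.diag).filt_eq_span]
      exact hu c)
  rw [injective_iff_map_eq_zero]
  intro p hp
  rw [linearIndependent_iff'] at hli
  ext c
  rw [MvPolynomial.coeff_zero]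
  by_contra hc
  refine hc (hli p.support p.coeff ?_ c (MvPolynomial.mem_support_iff.2 hc))
  have : ((MvPolynomial.aeval H.centralGen p : Subalgebra.center T (Weyl E B)) : Weyl E B) = 0 := by
    rw [hp]; rfl
  conv_lhs at this => rw [p.as_sum]
  rw [map_sum, AddSubmonoidClass.coe_finsetSum] at this
  rw [← this]
  refine Finset.sum_congr rfl fun c _ => ?_
  have hm : MvPolynomial.monomial c (p.coeff c) = p.coeff c • MvPolynomial.monomial c (1 : T) := by
    rw [MvPolynomial.smul_monomial, smul_eq_mul, mul_one]
  rw [hm, map_smul]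
  rfl

theorem aeval_surjective (H : RootParams E B d) : Function.Surjective
    (MvPolynomial.aeval H.centralGen :
      MvPolynomial (Fin n ⊕ Fin n) T →ₐ[T] Subalgebra.center T (Weyl E B)) := by
  set f := (MvPolynomial.aeval H.centralGen :
      MvPolynomial (Fin n ⊕ Fin n) T →ₐ[T] Subalgebra.center T (Weyl E B)) with hf
  have hle := (skewCommute_gens (E := E) H.diag).center_le (adjoin_gens E B)
    (linearIndependent_normalWord H.ne_one H.skew H.diag)
    (((Subalgebra.center T (Weyl E B)).val.comp f).range)
    (by rintro _ ⟨p, rfl⟩; exact (f p).2)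
    (fun s hs => by
      -- The quotients are exact by `dvd_of_forall_prod_eq_one`, so every admissible leading
      -- monomial is that of a monomial in the central generators.
      set c : Fin n ⊕ Fin n →₀ ℕ :=
        Finsupp.equivFunOnFinite.symm fun g => s.count g / d (pairIdx g) with hc
      have hcs : centralLead d c = s := by
        ext g
        rw [count_centralLead, hc]
        exact Nat.div_mul_cancel (H.dvd_of_forall_prod_eq_one hs g)
      have := H.hasLeading_monomial c
      rw [hcs] at this
      exact ⟨_, ⟨MvPolynomial.monomial c 1, rfl⟩, this⟩)
  rintro ⟨a, ha⟩
  obtain ⟨p, hp⟩ := hle ha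
  exact ⟨p, Subtype.ext hp⟩

end RootParams

end RootOfUnity

/-! ### The Poisson bracket induced by a specialization -/

section Induced

variable {T A' A : Type*} [CommRing T] [Ring A'] [Ring A] [Algebra T A] {σ : A' →+* A} {h : A'}

theorem IsSpecialization.exists_mul_eq (hσ : IsSpecialization σ h)
    {z : Subalgebra.center T A} {c c' : A'} (hc : σ c = z) :
    ∃ u, h * u = c * c' - c' * c := by
  obtain ⟨u, hu⟩ := (hσ.2 (c * c' - c' * c)).1 (by
    rw [map_sub, map_mul, map_mul, hc, Subalgebra.mem_center_iff.1 z.2, sub_self])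
  exact ⟨u, hu.symm⟩

/-- Independence of the lifts: replacing `c`, `c'` by `c + h a`, `c' + h b` changes the quotient by
`[a, c'] + [c, b] + h [a, b]`. Its image vanishes, as `c` and `c'` have central images and `h` maps
to zero. -/
theorem IsSpecialization.map_eq_map (hσ : IsSpecialization σ h) (hcomm : ∀ a, h * a = a * h)
    (hreg : ∀ a, h * a = 0 → a = 0) {z w : Subalgebra.center T A} {c c' e e' u v : A'}
    (hc : σ c = z) (hc' : σ c' = w) (he : σ e = z) (he' : σ e' = w)
    (hu : h * u = c * c' - c' * c) (hv : h * v = e * e' - e' * e) : σ u = σ v := by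
  obtain ⟨a, ha⟩ := (hσ.2 (e - c)).1 (by rw [map_sub, hc, he, sub_self])
  obtain ⟨b, hb⟩ := (hσ.2 (e' - c')).1 (by rw [map_sub, hc', he', sub_self])
  rw [sub_eq_iff_eq_add] at ha hb
  subst ha hb
  have h0 : σ h = 0 := (hσ.2 h).2 ⟨1, (mul_one h).symm⟩
  have hz : ∀ a, a * (z : A) = z * a := Subalgebra.mem_center_iff.1 z.2
  have hw : ∀ a, a * (w : A) = w * a := Subalgebra.mem_center_iff.1 w.2
  have key : v - u - ((a * c' - c' * a) + (c * b - b * c) + h * (a * b - b * a)) = 0 := by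
    refine hreg _ ?_
    have h1 : ∀ p q, p * (h * q) = h * (p * q) := fun p q => by
      rw [← mul_assoc, ← hcomm, mul_assoc]
    simp only [mul_sub, mul_add, hv, hu, add_mul, h1, mul_assoc]
    abel
  have := congrArg σ key
  simp only [map_sub, map_add, map_mul, hc, hc', h0, zero_mul, add_zero, map_zero, hz, hw,
    sub_self, sub_zero] at this
  exact (sub_eq_zero.1 this).symm

/-- A specialization by a central regular element induces a Poisson bracket on the center. -/
theorem IsSpecialization.exists_isInduced (hσ : IsSpecialization σ h)
    (hcomm : ∀ a, h * a = a * h) (hreg : ∀ a, h * a = 0 → a = 0)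
    (hscal : ∀ t : T, ∃ t' : A', (∀ a, t' * a = a * t') ∧ σ t' = algebraMap T A t) :
    ∃ P : PoissonBracket T (Subalgebra.center T A), IsInduced σ h P := by
  have h1 : ∀ p q, p * (h * q) = h * (p * q) := fun p q => by
    rw [← mul_assoc, ← hcomm, mul_assoc]
  have h0 : σ h = 0 := (hσ.2 h).2 ⟨1, (mul_one h).symm⟩
  choose s hs using hσ.1
  have hex : ∀ z w : Subalgebra.center T A, ∃ u, h * u = s z * s w - s w * s z := fun z w =>
    hσ.exists_mul_eq (hs z)
  choose u hu using hex
  have hcen : ∀ z w, σ (u z w) ∈ Subalgebra.center T A := by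
    intro z w
    rw [Subalgebra.mem_center_iff]
    intro b
    obtain ⟨b, rfl⟩ := hσ.1 b
    obtain ⟨p, hp⟩ := hσ.exists_mul_eq (c' := b) (hs z)
    obtain ⟨q, hq⟩ := hσ.exists_mul_eq (c' := b) (hs w)
    obtain ⟨p', hp'⟩ := hσ.exists_mul_eq (c' := p) (hs w)
    obtain ⟨q', hq'⟩ := hσ.exists_mul_eq (c' := q) (hs z)
    -- By the Jacobi identity for commutators, `[b, [z, w]]` is a difference of double commutators
    -- with lifts of central elements. Each of the two commutators is divisible by `h`, while the
    -- bracket uses up only one division, so a factor `h` remains.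
    have key : (b * u z w - u z w * b) - h * (p' - q') = 0 := by
      refine hreg _ (hreg _ ?_)
      have e1 : h * (h * (b * u z w - u z w * b)) =
          h * (b * (s z * s w - s w * s z) - (s z * s w - s w * s z) * b) := by
        rw [← hu, h1 b, mul_assoc h, ← mul_sub]
      have e2 : h * (h * (h * (p' - q'))) = h *
          ((s w * (s z * b - b * s z) - (s z * b - b * s z) * s w) -
            (s z * (s w * b - b * s w) - (s w * b - b * s w) * s z)) := by
        rw [← hp, ← hq, mul_sub h p' q', hp', hq']
        simp only [mul_sub, h1, mul_assoc]
      rw [mul_sub, mul_sub, e1, e2, ← mul_sub]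
      noncomm_ring
    have := congrArg σ key
    simp only [map_sub, map_mul, h0, zero_mul, sub_zero, map_zero] at this
    exact sub_eq_zero.1 this
  set br : Subalgebra.center T A → Subalgebra.center T A → Subalgebra.center T A :=
    fun z w => ⟨σ (u z w), hcen z w⟩
  have hbr : ∀ {z w : Subalgebra.center T A} {c c' v : A'}, σ c = z → σ c' = w →
      h * v = c * c' - c' * c → (br z w : A) = σ v := fun hc hc' hv =>
    hσ.map_eq_map hcomm hreg (hs _) (hs _) hc hc' (hu _ _) hv
  refine ⟨⟨LinearMap.mk₂ T br ?_ ?_ ?_ ?_, ?_, ?_, ?_⟩, ?_⟩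
  · intro z z' w
    refine Subtype.ext ?_
    rw [hbr (c := s z + s z') (c' := s w) (v := u z w + u z' w) (by simp [hs]) (hs w)
      (by rw [mul_add, hu, hu]; noncomm_ring), map_add]
    rfl
  · intro t z w
    obtain ⟨t', ht, hσt⟩ := hscal t
    refine Subtype.ext ?_
    rw [hbr (c := t' * s z) (c' := s w) (v := t' * u z w)
      (by simp [hs, hσt, Algebra.smul_def]) (hs w)
      (by rw [← mul_assoc, ← ht, mul_assoc, hu, mul_sub, ← mul_assoc (s w), ← ht]
          noncomm_ring), map_mul, hσt, ← Algebra.smul_def]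
    rfl
  · intro z w w'
    refine Subtype.ext ?_
    rw [hbr (c := s z) (c' := s w + s w') (v := u z w + u z w') (hs z) (by simp [hs])
      (by rw [mul_add, hu, hu]; noncomm_ring), map_add]
    rfl
  · intro t z w
    obtain ⟨t', ht, hσt⟩ := hscal t
    refine Subtype.ext ?_
    rw [hbr (c := s z) (c' := t' * s w) (v := t' * u z w) (hs z)
      (by simp [hs, hσt, Algebra.smul_def])
      (by rw [← mul_assoc, ← ht, mul_assoc, hu, mul_sub, ← mul_assoc (s z), ← ht]
          noncomm_ring), map_mul, hσt, ← Algebra.smul_def]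
    rfl
  · intro z
    refine Subtype.ext ?_
    rw [LinearMap.mk₂_apply, hbr (v := 0) (hs z) (hs z) (by simp), map_zero]
    rfl
  · intro z w v
    simp only [LinearMap.mk₂_apply]
    have hex2 : ∀ a b c : Subalgebra.center T A, ∃ p,
        h * p = s a * u b c - u b c * s a := fun a b c => hσ.exists_mul_eq (hs a)
    obtain ⟨p, hp⟩ := hex2 z w v
    obtain ⟨q, hq⟩ := hex2 w v z
    obtain ⟨r, hr⟩ := hex2 v z w
    have key : p + q + r = 0 := by
      refine hreg _ (hreg _ ?_)
      have e : ∀ a b c, h * (s a * u b c - u b c * s a) =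
          s a * (h * u b c) - (h * u b c) * s a := fun a b c => by rw [mul_sub, h1, mul_assoc]
      simp only [mul_add, hp, hq, hr, e, hu]
      noncomm_ring
    refine Subtype.ext ?_
    rw [AddMemClass.coe_add, AddMemClass.coe_add, hbr (z := z) (w := br w v) (hs z) rfl hp,
      hbr (z := w) (w := br v z) (hs w) rfl hq, hbr (z := v) (w := br z w) (hs v) rfl hr,
      ← map_add, ← map_add, key, map_zero]
    rfl
  · intro z w v
    simp only [LinearMap.mk₂_apply]
    refine Subtype.ext ?_
    rw [hbr (c := s z) (c' := s w * s v) (v := u z w * s v + s w * u z v) (hs z) (by simp [hs])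
      (by rw [mul_add, ← h1 (s w), ← mul_assoc h, hu, hu]; noncomm_ring), map_add, map_mul, map_mul,
      hs, hs]
    rfl
  · intro z w c c' hc hc'
    exact ⟨hσ.exists_mul_eq hc, fun v hv => hbr hc hc' hv⟩

end Induced

/-! ### Evaluation of Laurent polynomials at `ε` -/

section Laurent

variable {T : Type*} [CommRing T]

open LaurentPolynomial

/-- Multiplication by a power of `q` reduces this to the factor theorem for ordinary polynomials. -/
theorem exists_eq_mul_of_evalQ_eq_zero (ε : Tˣ) {f : LaurentPolynomial T} (hf : evalQ ε f = 0) :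
    ∃ g, f = (LaurentPolynomial.T 1 - LaurentPolynomial.C (ε : T)) * g := by
  obtain ⟨k, p, hp⟩ := f.exists_T_pow
  have h1 : p.eval (ε : T) = 0 := by
    have := congrArg (evalQ ε) hp
    rw [map_mul, hf, zero_mul, evalQ, eval₂_toLaurent] at this
    exact this
  obtain ⟨g, hg⟩ := Polynomial.dvd_iff_isRoot.2 h1
  refine ⟨Polynomial.toLaurent g * LaurentPolynomial.T (-k), ?_⟩
  have h2 : f = Polynomial.toLaurent p * LaurentPolynomial.T (-k) := by
    rw [hp, mul_assoc, ← T_add, add_neg_cancel, T_zero, mul_one]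
  rw [h2, hg, map_mul, map_sub, Polynomial.toLaurent_X, Polynomial.toLaurent_C, mul_assoc]

@[simp] theorem evalQ_C (ε : Tˣ) (t : T) : evalQ ε (LaurentPolynomial.C t) = t := by
  simp [evalQ]

theorem evalQ_qUnit (ε : Tˣ) : evalQ ε (qUnit T : LaurentPolynomial T) = ε :=
  congrArg Units.val (map_evalQ_qUnit ε)

theorem evalQ_qUnit_zpow (ε : Tˣ) (k : ℤ) :
    evalQ ε ((qUnit T ^ k : (LaurentPolynomial T)ˣ) : LaurentPolynomial T) = (ε ^ k : Tˣ) := by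
  have := congrArg (fun u : Tˣ => ((u ^ k : Tˣ) : T)) (map_evalQ_qUnit ε)
  rwa [← map_zpow] at this

/-- The quotient of `q ^ N - 1` by `q - ε` takes the value `N ε⁻¹` at `ε`, if `ε ^ N = 1`. -/
theorem exists_qUnit_zpow_sub_one (ε : Tˣ) {N : ℤ} (hN : ε ^ N = 1) :
    ∃ g, ((qUnit T ^ N : (LaurentPolynomial T)ˣ) : LaurentPolynomial T) - 1 =
      (LaurentPolynomial.T 1 - LaurentPolynomial.C (ε : T)) * g ∧
      evalQ ε g = N * ((ε⁻¹ : Tˣ) : T) := by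
  have hnat : ∀ k : ℕ, ε ^ k = 1 →
      ∃ g, ((qUnit T ^ k : (LaurentPolynomial T)ˣ) : LaurentPolynomial T) - 1 =
      (LaurentPolynomial.T 1 - LaurentPolynomial.C (ε : T)) * g ∧
      evalQ ε g = k * ((ε⁻¹ : Tˣ) : T) := by
    intro k hk
    -- The quotient is the geometric sum for `q^k - ε^k`. At `q = ε` each of its `k` terms is
    -- `ε^{k-1} = ε⁻¹`.
    refine ⟨∑ i ∈ Finset.range k, (qUnit T : LaurentPolynomial T) ^ i *
      LaurentPolynomial.C (ε : T) ^ (k - 1 - i), ?_, ?_⟩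
    · have hq : LaurentPolynomial.T 1 = (qUnit T : LaurentPolynomial T) := rfl
      rw [mul_comm, hq, Commute.geom_sum₂_mul (Commute.all _ _), ← map_pow,
        ← Units.val_pow_eq_pow_val ε, hk, Units.val_one, map_one, Units.val_pow_eq_pow_val]
    · rw [map_sum, Finset.sum_congr rfl (g := fun _ => ((ε⁻¹ : Tˣ) : T))]
      · simp
      · intro i hi
        rw [map_mul, map_pow, map_pow, evalQ_qUnit, evalQ_C, ← pow_add,
          ← Units.val_pow_eq_pow_val]
        congr 1
        rw [eq_inv_iff_mul_eq_one, ← pow_succ, ← hk]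
        congr 1
        have := Finset.mem_range.1 hi
        omega
  obtain ⟨k, rfl | rfl⟩ := N.eq_nat_or_neg
  · obtain ⟨g, hg, hg'⟩ := hnat k (by simpa using hN)
    exact ⟨g, by simpa using hg, by simpa using hg'⟩
  · obtain ⟨g, hg, hg'⟩ := hnat k (by simpa using hN)
    -- Negative exponents reduce to positive ones by `q^{-k} - 1 = -q^{-k} (q^k - 1)`.
    refine ⟨-((qUnit T ^ (-(k : ℤ)) : (LaurentPolynomial T)ˣ) : LaurentPolynomial T) * g, ?_, ?_⟩
    · rw [mul_left_comm, ← hg, neg_mul, mul_sub, ← Units.val_mul, zpow_neg, zpow_natCast,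
        inv_mul_cancel, Units.val_one, mul_one, neg_sub]
    · rw [map_mul, map_neg, evalQ_qUnit_zpow, hN, hg']
      simp

end Laurent

/-! ### The specialization `q ↦ ε` and its brackets -/

section Spec

variable {T : Type*} [CommRing T] {n : ℕ} [NeZero n]
  {ε : Tˣ} {m d : Fin n → ℕ} {mm : Fin n → Fin n → ℤ} {dd : Fin n → Fin n → ℕ}

theorem spec_smul (f : LaurentPolynomial T) (a : WeylQ T m d mm dd) :
    spec ε m d mm dd (f • a) = evalQ ε f • spec ε m d mm dd a :=
  baseChange_smul _ _ _ f a

theorem spec_normalWord (s : Multiset (Fin n ⊕ Fin n)) :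
    spec ε m d mm dd (normalWord (gens _ _) s) = normalWord (gens _ _) s :=
  baseChange_word _ _ _ _

theorem spec_zz (j : Fin (n + 1)) : spec ε m d mm dd (zz _ _ j) = zz _ _ j := by
  have hE : ∀ i, evalQ ε ((parE (qUnit T) m d i : (LaurentPolynomial T)ˣ) : LaurentPolynomial T) =
      ((parE ε m d i : Tˣ) : T) := by
    intro i
    have := evalQ_qUnit_zpow ε ((d (lastIdx n) / d i * m i : ℕ) : ℤ)
    rwa [zpow_natCast, zpow_natCast] at this
  simp only [zz, map_add, map_one, map_sum, spec_smul, map_mul, map_sub, spec_x, spec_y, hE]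

theorem spec_surjective : Function.Surjective (spec ε m d mm dd) := by
  intro a
  have ha : a ∈ Algebra.adjoin T (Set.range (gens (parE ε m d) (parB ε d mm dd))) :=
    by rw [adjoin_gens]; exact Algebra.mem_top
  induction ha using Algebra.adjoin_induction with
  | mem a ha =>
    obtain ⟨g | g, rfl⟩ := ha
    · exact ⟨x _ _ g, spec_x ε m d mm dd g⟩
    · exact ⟨y _ _ g, spec_y ε m d mm dd g⟩
  | algebraMap t =>
    exact ⟨algebraMap _ _ (LaurentPolynomial.C t), by rw [spec_algebraMap, evalQ_C]⟩
  | add a b _ _ ha hb =>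
    obtain ⟨a, rfl⟩ := ha
    obtain ⟨b, rfl⟩ := hb
    exact ⟨a + b, map_add _ _ _⟩
  | mul a b _ _ ha hb =>
    obtain ⟨a, rfl⟩ := ha
    obtain ⟨b, rfl⟩ := hb
    exact ⟨a * b, map_mul _ _ _⟩

theorem qSub_mul (a : WeylQ T m d mm dd) : qSub ε m d mm dd * a =
    (LaurentPolynomial.T 1 - LaurentPolynomial.C (ε : T)) • a :=
  (Algebra.smul_def _ _).symm

theorem spec_qSub : spec ε m d mm dd (qSub ε m d mm dd) = 0 := by
  rw [qSub, spec_algebraMap, map_sub, evalQ_C]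
  have : evalQ ε (LaurentPolynomial.T 1) = (ε : T) := evalQ_qUnit ε
  rw [this, sub_self, map_zero]

/-- The commutator of the lifts is `(q^N - 1) c' c`; dividing by `q - ε` and evaluating leaves `N
ε⁻¹`. -/
theorem IsInduced.br_eq_of_qCommute
    {P : PoissonBracket T (Subalgebra.center T (WeylAt ε m d mm dd))}
    (hP : IsInduced (spec ε m d mm dd) (qSub ε m d mm dd) P)
    {z w : Subalgebra.center T (WeylAt ε m d mm dd)} {c c' : WeylQ T m d mm dd}
    (hc : spec ε m d mm dd c = z) (hc' : spec ε m d mm dd c' = w) {N : ℤ}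
    (h : QCommute (qUnit T ^ N) c c') (hN : ε ^ N = 1) :
    P.br z w = (N * ((ε⁻¹ : Tˣ) : T)) • (z * w) := by
  obtain ⟨g, hg, hg'⟩ := exists_qUnit_zpow_sub_one ε hN
  refine Subtype.ext ?_
  rw [(hP z w c c' hc hc').2 (g • (c' * c)), spec_smul, map_mul, hg', hc, hc', mul_comm z w]
  · rfl
  · rw [QCommute] at h
    rw [qSub_mul, smul_smul, ← hg, sub_smul, one_smul, h]

theorem IsInduced.br_pow_pow
    {P : PoissonBracket T (Subalgebra.center T (WeylAt ε m d mm dd))}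
    (hP : IsInduced (spec ε m d mm dd) (qSub ε m d mm dd) P)
    {z w : Subalgebra.center T (WeylAt ε m d mm dd)} {a b : WeylQ T m d mm dd} {k l : ℕ}
    (hz : (z : WeylAt ε m d mm dd) = spec ε m d mm dd a ^ k)
    (hw : (w : WeylAt ε m d mm dd) = spec ε m d mm dd b ^ l) {e : ℤ}
    (h : QCommute (qUnit T ^ e) a b) (he : ε ^ (e * (k * l)) = 1) :
    P.br z w = (e * (k * l) * ((ε⁻¹ : Tˣ) : T)) • (z * w) := by
  have := hP.br_eq_of_qCommute (c := a ^ k) (c' := b ^ l) (N := e * (k * l))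
    (by rw [map_pow, hz]) (by rw [map_pow, hw])
    (by
      have := h.pow_pow k l
      rwa [← zpow_natCast, ← zpow_mul, Nat.cast_mul] at this) he
  rw [this]
  push_cast
  rfl

theorem PoissonBracket.br_swap {P : Type*} [CommRing P] [Algebra T P] (p : PoissonBracket T P)
    (a b : P) : p.br a b = -p.br b a := by
  have := p.self (a + b)
  simp only [map_add, LinearMap.add_apply, p.self, zero_add, add_zero] at this
  rw [eq_neg_iff_add_eq_zero, add_comm]
  exact this

variable [IsDomain T]

/-- Ordered monomials upstairs map to ordered monomials downstairs, which are independent. An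
element of the kernel therefore has all its coefficients vanishing at `ε`, hence divisible by `q -
ε`. -/
theorem isSpecialization_spec (hE : ∀ j, parE ε m d j ≠ 1)
    (hB : ∀ j k, parB ε d mm dd j k * parB ε d mm dd k j = 1) (hB' : ∀ j, parB ε d mm dd j j = 1)
    (hqB' : ∀ j, parB (qUnit T) d mm dd j j = 1) :
    IsSpecialization (spec ε m d mm dd) (qSub ε m d mm dd) := by
  refine ⟨spec_surjective, fun a => ⟨fun ha => ?_, ?_⟩⟩
  · have hmem : a ∈ Submodule.span (LaurentPolynomial T)
        (Set.range (normalWord (gens (parE (qUnit T) m d) (parB (qUnit T) d mm dd)))) := by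
      rw [(skewCommute_gens hqB').span_normalWord (adjoin_gens _ _)]
      trivial
    obtain ⟨c, rfl⟩ := (Finsupp.mem_span_range_iff_exists_finsupp).1 hmem
    rw [Finsupp.sum, map_sum] at ha
    simp only [spec_smul, spec_normalWord] at ha
    have hc := linearIndependent_iff'.1 (linearIndependent_normalWord hE hB hB') c.support _ ha
    have hg : ∀ s, ∃ g, c s = (LaurentPolynomial.T 1 - LaurentPolynomial.C (ε : T)) * g := by
      intro s
      by_cases hs : s ∈ c.support
      · exact exists_eq_mul_of_evalQ_eq_zero ε (hc s hs)
      · exact ⟨0, by rw [Finsupp.notMem_support_iff.1 hs, mul_zero]⟩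
    choose g hg using hg
    refine ⟨∑ s ∈ c.support, g s • normalWord (gens _ _) s, ?_⟩
    rw [qSub_mul, Finset.smul_sum, Finsupp.sum]
    exact Finset.sum_congr rfl fun s _ => by rw [hg s, mul_smul]
  · rintro ⟨u, rfl⟩
    rw [map_mul, spec_qSub, zero_mul]

theorem qSub_regular (hqE : ∀ j, parE (qUnit T) m d j ≠ 1)
    (hqB : ∀ j k, parB (qUnit T) d mm dd j k * parB (qUnit T) d mm dd k j = 1)
    (hqB' : ∀ j, parB (qUnit T) d mm dd j j = 1) (a : WeylQ T m d mm dd)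
    (ha : qSub ε m d mm dd * a = 0) : a = 0 := by
  have hne : (LaurentPolynomial.T 1 - LaurentPolynomial.C (ε : T) : LaurentPolynomial T) ≠ 0 := by
    intro h
    have := congrArg LaurentPolynomial.degree (sub_eq_zero.1 h)
    rw [LaurentPolynomial.degree_T, LaurentPolynomial.degree_C ε.ne_zero] at this
    simp at this
  rw [qSub_mul] at ha
  have hb := pbwBasis hqE hqB hqB'
  refine hb.repr.injective ?_
  ext s : 1
  have := congrArg (fun a => hb.repr a s) ha
  simpa [hne] using this

end Spec

/-! ### The central elements `Z_j` and the denominators `(1 - ε_j)^{d_j}` -/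

section CentralSequence

variable {T : Type*} [CommRing T] {n : ℕ} {E : Fin n → Tˣ} {B : Fin n → Fin n → Tˣ}
  {d : Fin n → ℕ}

theorem RootParams.cons_dvd (H : RootParams E B d) (j : Fin n) :
    (Fin.cons 1 d : Fin (n + 1) → ℕ) j.castSucc ∣ d j := by
  -- Freeing the index allows a split between the convention `d_0 = 1` and a genuine predecessor.
  have key : ∀ i : Fin (n + 1), i ≤ j.castSucc → (Fin.cons 1 d : Fin (n + 1) → ℕ) i ∣ d j := by
    intro i hi
    induction i using Fin.cases with
    | zero => simp
    | succ i =>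
      rw [Fin.cons_succ]
      exact H.dvd i j (Fin.succ_le_castSucc_iff.1 hi).le
  exact key _ le_rfl

theorem Zseq_succ {C : Type*} [Ring C] [Algebra T C] (X Y : Fin n → C) (j : Fin n) :
    Zseq E d X Y j.succ =
      -((1 - (E j : T)) ^ d j • (Y j * X j)) + Zseq E d X Y j.castSucc ^ ratio d j := by
  simp [Zseq, Fin.induction_succ]

/-- A bracket `{X, Y}` is determined by the brackets of `X` with `W` and with `W - t Y X`. -/
theorem PoissonBracket.br_eq_of_cancel {C : Type*} [CommRing C] [IsDomain C] [Algebra T C]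
    (P : PoissonBracket T C) {X Y Zs W : C} {t r s c : T}
    (ht : ∀ a b : C, t • a = t • b → a = b) (hX : X ≠ 0)
    (hZ : Zs = -(t • (Y * X)) + W) (hW : P.br W X = 0) (hZX : P.br Zs X = -(r * s) • (Zs * X))
    (hc : t * c = s) : P.br X Y = r • (s • (X * Y) - c • W) := by
  have h1 : t • (P.br X Y * X) = -(r * s) • (Zs * X) := by
    rw [← hZX, P.br_swap Zs X, hZ, map_add, map_neg, map_smul, P.leibniz, P.self,
      P.br_swap X W, hW]
    simp
  -- The Leibniz rule determines the bracket only after multiplication by `t` and by `X`; both are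
  -- cancelled here.
  refine ht _ _ (mul_right_cancel₀ hX ?_)
  rw [smul_mul_assoc, h1, hZ, ← hc]
  simp only [Algebra.smul_def, map_mul, map_neg]
  ring

variable [IsDomain T]

/-- The recursion for `Z_j` is the factorization identity with `z_{j-1}^{d_j}` written as the `d_j /
d_{j-1}`-th power of `z_{j-1}^{d_{j-1}}`. -/
theorem RootParams.coe_Zseq (H : RootParams E B d)
    {X Y : Fin n → Subalgebra.center T (Weyl E B)}
    (hX : ∀ j, (X j : Weyl E B) = x E B j ^ d j) (hY : ∀ j, (Y j : Weyl E B) = y E B j ^ d j)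
    (i : Fin (n + 1)) :
    ((Zseq E d X Y i : Subalgebra.center T (Weyl E B)) : Weyl E B) = zz E B i ^ (Fin.cons 1 d : Fin (n + 1) → ℕ) i := by
  induction i using Fin.induction with
  | zero => simp [Zseq, zz_zero]
  | succ j ih =>
    have hcoe : (((1 - (E j : T)) ^ d j • (Y j * X j) : Subalgebra.center T (Weyl E B)) :
        Weyl E B) = (1 - (E j : T)) ^ d j • ((Y j : Weyl E B) * X j) := rfl
    rw [Zseq_succ, AddMemClass.coe_add, NegMemClass.coe_neg, SubmonoidClass.coe_pow, hcoe, ih,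
      ← pow_mul, ratio, Nat.mul_div_cancel' (H.cons_dvd j), hX, hY,
      smul_y_pow_mul_x_pow H.skew j (H.pos j) (IsPrimitiveRoot.coe_units_iff.2 (H.prim j)),
      Fin.cons_succ]
    abel

theorem RootParams.coe_Zseq_pow (H : RootParams E B d)
    {X Y : Fin n → Subalgebra.center T (Weyl E B)}
    (hX : ∀ j, (X j : Weyl E B) = x E B j ^ d j) (hY : ∀ j, (Y j : Weyl E B) = y E B j ^ d j)
    (j : Fin n) :
    ((Zseq E d X Y j.castSucc ^ ratio d j : Subalgebra.center T (Weyl E B)) : Weyl E B) =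
      zz E B j.castSucc ^ d j := by
  rw [SubmonoidClass.coe_pow, H.coe_Zseq hX hY, ← pow_mul, ratio,
    Nat.mul_div_cancel' (H.cons_dvd j)]

theorem RootParams.isDomain_center (H : RootParams E B d) :
    IsDomain (Subalgebra.center T (Weyl E B)) :=
  (AlgEquiv.ofBijective (MvPolynomial.aeval (R := T) H.centralGen)
    ⟨H.aeval_injective, H.aeval_surjective⟩).symm.toMulEquiv.isDomain _

theorem RootParams.centralGen_ne_zero (H : RootParams E B d) (g : Fin n ⊕ Fin n) :
    H.centralGen g ≠ 0 := by
  intro h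
  have : MvPolynomial.aeval H.centralGen (MvPolynomial.X g : MvPolynomial (Fin n ⊕ Fin n) T) =
      MvPolynomial.aeval (R := T) H.centralGen 0 := by
    rw [MvPolynomial.aeval_X, h, map_zero]
  exact MvPolynomial.X_ne_zero g (H.aeval_injective this)

/-- For a primitive `d`-th root of unity `ζ`, every power `(ζ - 1)^k` with `k < d` divides `d`.
Taking `k = d - 1` for one factor `d_j` and `k = 1` for the copy of `d_j` inside `N` yields the full
power `d_j`; the latter needs `1 < d_j`, which is `ε_j ≠ 1`. -/
theorem RootParams.exists_mul_eq (H : RootParams E B d) {j : Fin n} {N : ℕ} (hN : d j ∣ N) :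
    ∃ c : T, (1 - (E j : T)) ^ d j * c = d j * N := by
  have hprim := IsPrimitiveRoot.coe_units_iff.2 (H.prim j)
  have h1 : 1 < d j := by
    refine lt_of_le_of_ne (H.pos j) fun h => H.ne_one j ?_
    have := (H.prim j).pow_eq_one
    rwa [← h, pow_one] at this
  obtain ⟨a, -, ha⟩ := hprim.self_sub_one_pow_dvd_order (Nat.sub_lt (H.pos j) one_pos)
  obtain ⟨b, -, hb⟩ := hprim.self_sub_one_pow_dvd_order h1
  obtain ⟨e, rfl⟩ := hN
  refine ⟨(-1) ^ d j * (a * b * e), ?_⟩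
  have hpow : ((E j : T) - 1) ^ d j = ((E j : T) - 1) ^ (d j - 1) * ((E j : T) - 1) ^ 1 := by
    rw [← pow_add, Nat.sub_add_cancel (H.pos j)]
  rw [← mul_assoc, ← mul_pow, mul_neg_one, neg_sub, hpow, Nat.cast_mul]
  linear_combination (-((E j : T) - 1) ^ 1 * b * e) * ha - (d j * e : T) * hb

end CentralSequence

/-! ### Arithmetic of the parameters -/

section Parameters

variable {n : ℕ} [NeZero n] {m d : Fin n → ℕ} {mm : Fin n → Fin n → ℤ}
  {dd : Fin n → Fin n → ℕ}

theorem le_lastIdx (j : Fin n) : j ≤ lastIdx n := by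
  rw [Fin.le_def]
  exact Nat.le_sub_one_of_lt j.2

theorem parB_mul_parB {U : Type*} [CommGroup U] (u : U) (hdd_symm : ∀ j k, dd j k = dd k j)
    (hmm_skew : ∀ j k, mm j k = -mm k j) (j k : Fin n) :
    parB u d mm dd j k * parB u d mm dd k j = 1 := by
  rw [parB, parB, ← zpow_add, hdd_symm j k, hmm_skew j k, ← mul_add, neg_add_cancel, mul_zero,
    zpow_zero]

theorem parB_self {U : Type*} [CommGroup U] (u : U) (hmm_skew : ∀ j k, mm j k = -mm k j)
    (j : Fin n) : parB u d mm dd j j = 1 := by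
  have : mm j j = 0 := by have := hmm_skew j j; omega
  rw [parB, this, mul_zero, zpow_zero]

variable {T : Type*} [CommRing T]

theorem parE_qUnit_ne_one {ε : Tˣ} {j : Fin n} (h : parE ε m d j ≠ 1) :
    parE (qUnit T) m d j ≠ 1 := by
  intro hq
  refine h ?_
  rw [parE, ← map_evalQ_qUnit ε, ← map_pow]
  exact (congrArg _ hq).trans (map_one _)

theorem rootParams_par (hd : ∀ j, 0 < d j) (hmd : ∀ j, Nat.Coprime (m j) (d j))
    (hdd_symm : ∀ j k, dd j k = dd k j) (hmm_skew : ∀ j k, mm j k = -mm k j)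
    (hdvd : ∀ j l, j ≤ l → d j ∣ d l) (hddvd : ∀ j l k, j ≤ l → dd j k ∣ d l)
    {ε : Tˣ} (hε : IsPrimitiveRoot (ε : T) (d (lastIdx n))) (hE : ∀ j, parE ε m d j ≠ 1) :
    RootParams (parE ε m d) (parB ε d mm dd) d where
  ne_one := hE
  skew := parB_mul_parB ε hdd_symm hmm_skew
  diag := parB_self ε hmm_skew
  pos := hd
  prim j := by
    have h := (IsPrimitiveRoot.coe_units_iff.1 hε).pow (hd _)
      (Nat.div_mul_cancel (hdvd j _ (le_lastIdx j))).symm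
    rw [parE, pow_mul]
    exact h.pow_of_coprime _ (hmd j)
  pow j k := by
    obtain ⟨e, he⟩ := hddvd j j k le_rfl
    -- Since `d_jk` divides `d_j`, the exponent of `ε` in `β_jk^{d_j}` is a multiple of `d_n`.
    have h : ((d (lastIdx n) / dd j k : ℕ) : ℤ) * mm j k * (d j : ℕ) =
        (d (lastIdx n) : ℕ) * (mm j k * e) := by
      conv_rhs => rw [← Nat.div_mul_cancel (hddvd j _ k (le_lastIdx j))]
      rw [he]
      push_cast
      ring
    rw [parB, ← zpow_natCast, ← zpow_mul, h, zpow_mul, zpow_natCast,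
      (IsPrimitiveRoot.coe_units_iff.1 hε).pow_eq_one, one_zpow]
  dvd := hdvd

end Parameters

end QWeyl

/-! ### The main theorem -/

open QWeyl in
theorem mainTheorem9 {T : Type*} [CommRing T] [IsDomain T] (n : ℕ) [NeZero n]
    (m d : Fin n → ℕ) (mm : Fin n → Fin n → ℤ) (dd : Fin n → Fin n → ℕ)
    (hm : ∀ j, 0 < m j) (hd : ∀ j, 0 < d j) (hdd : ∀ j k, 0 < dd j k)
    (hmd : ∀ j, Nat.Coprime (m j) (d j))
    (hmmdd : ∀ j k, IsCoprime (mm j k) (dd j k : ℤ))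
    (hdd_symm : ∀ j k, dd j k = dd k j) (hmm_skew : ∀ j k, mm j k = -mm k j)
    (hdvd : ∀ j l, j ≤ l → d j ∣ d l) (hddvd : ∀ j l k, j ≤ l → dd j k ∣ d l)
    (ε : Tˣ) (hε : IsPrimitiveRoot (ε : T) (d (lastIdx n)))
    (hE : ∀ j, parE ε m d j ≠ 1) :
    let E : Fin n → Tˣ := parE ε m d
    let B : Fin n → Fin n → Tˣ := parB ε d mm dd
    let σ : WeylQ T m d mm dd →+* Weyl E B := spec ε m d mm dd
    let ε' : T := ((ε⁻¹ : Tˣ) : T)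
    let dn : ℕ := d (lastIdx n)
    IsSpecialization σ (qSub ε m d mm dd) ∧
    ∃ X Y : Fin n → Subalgebra.center T (Weyl E B),
      (∀ j, (X j : Weyl E B) = x E B j ^ d j) ∧
      (∀ j, (Y j : Weyl E B) = y E B j ^ d j) ∧
      Function.Bijective (MvPolynomial.aeval (Sum.elim X Y) :
        MvPolynomial (Fin n ⊕ Fin n) T →ₐ[T] Subalgebra.center T (Weyl E B)) ∧
      let Z : Fin (n + 1) → Subalgebra.center T (Weyl E B) := Zseq E d X Y
      (∀ j, σ (z (parE (qUnit T) m d) (parB (qUnit T) d mm dd) j) ^ d j = z E B j ^ d j ∧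
        z E B j ^ d j = (Z j.succ : Weyl E B)) ∧
      ∃ P : PoissonBracket T (Subalgebra.center T (Weyl E B)),
        IsInduced σ (qSub ε m d mm dd) P ∧
        -- `c` is the element `d_j d_n (1 - ε_j)^{-d_j}` of `T`
        (∀ j, ∃ c : T, (1 - (E j : T)) ^ d j * c = d j * dn ∧
          P.br (X j) (Y j) =
            (m j * ε' : T) • ((d j * dn : T) • (X j * Y j) - c • Z j.castSucc ^ ratio d j)) ∧
        (∀ j k, P.br (Y j) (Y k) =
          (mm j k * d j * d k * (dn / dd j k : ℕ) * ε' : T) • (Y j * Y k)) ∧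
        (∀ j k, j < k → P.br (X j) (Y k) =
          -(mm j k * d j * d k * (dn / dd j k : ℕ) * ε' : T) • (X j * Y k)) ∧
        (∀ j k, j < k → P.br (X j) (X k) =
          (d j * d k * (m j * (dn / d j : ℕ) + mm j k * (dn / dd j k : ℕ)) * ε' : T) •
            (X j * X k)) ∧
        (∀ j k, k < j → P.br (X j) (Y k) =
          (d j * d k * (m k * (dn / d k : ℕ) + mm k j * (dn / dd k j : ℕ)) * ε' : T) •
            (X j * Y k)) ∧
        (∀ j k, P.br (Z j.succ) (X k) =
          (if k ≤ j then -(m k * d j * dn * ε' : T) else 0) • (Z j.succ * X k)) ∧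
        (∀ j k, P.br (Z j.succ) (Y k) =
          (if k ≤ j then (m k * d j * dn * ε' : T) else 0) • (Z j.succ * Y k)) ∧
        (∀ j k : Fin n, P.br (Z j.succ) (Z k.succ) = 0) := by
  intro E B σ ε' dn
  have H : RootParams E B d :=
    rootParams_par hd hmd hdd_symm hmm_skew hdvd hddvd hε hE
  have hqE : ∀ j, parE (qUnit T) m d j ≠ 1 := fun j => parE_qUnit_ne_one (hE j)
  have hqB : ∀ j k, parB (qUnit T) d mm dd j k * parB (qUnit T) d mm dd k j = 1 :=
    parB_mul_parB _ hdd_symm hmm_skew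
  have hqB' : ∀ j, parB (qUnit T) d mm dd j j = 1 := parB_self _ hmm_skew
  have hσ : IsSpecialization σ (qSub ε m d mm dd) :=
    isSpecialization_spec hE H.skew H.diag hqB'
  obtain ⟨P, hP⟩ := hσ.exists_isInduced (T := T) (fun a => Algebra.commutes _ a)
    (qSub_regular hqE hqB hqB')
    (fun t => ⟨algebraMap _ _ (LaurentPolynomial.C t), fun a => Algebra.commutes _ a, by
      rw [spec_algebraMap, evalQ_C]⟩)
  set X : Fin n → Subalgebra.center T (Weyl E B) := fun j => H.centralGen (Sum.inl j)
  set Y : Fin n → Subalgebra.center T (Weyl E B) := fun j => H.centralGen (Sum.inr j)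
  have hX : ∀ j, (X j : Weyl E B) = x E B j ^ d j := fun j => rfl
  have hY : ∀ j, (Y j : Weyl E B) = y E B j ^ d j := fun j => rfl
  have hXY : Sum.elim X Y = H.centralGen := by funext g; cases g <;> rfl
  have hσX : ∀ j, (X j : Weyl E B) = spec ε m d mm dd (x _ _ j) ^ d j := fun j => by
    rw [spec_x]; rfl
  have hσY : ∀ j, (Y j : Weyl E B) = spec ε m d mm dd (y _ _ j) ^ d j := fun j => by
    rw [spec_y]; rfl
  have hσZ : ∀ j : Fin n,
      ((Zseq E d X Y j.succ : Subalgebra.center T (Weyl E B)) : Weyl E B) =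
      spec ε m d mm dd (zz _ _ j.succ) ^ d j := fun j => by
    rw [spec_zz, H.coe_Zseq hX hY, Fin.cons_succ]
  have hσW : ∀ j : Fin n,
      ((Zseq E d X Y j.castSucc ^ ratio d j : Subalgebra.center T (Weyl E B)) : Weyl E B) =
      spec ε m d mm dd (zz _ _ j.castSucc) ^ d j := fun j => by
    rw [spec_zz, H.coe_Zseq_pow hX hY]
  have hεB : ∀ j k (l : ℕ), ε ^ (((dn / dd j k : ℕ) : ℤ) * mm j k * (d j * l)) = 1 := by
    intro j k l
    rw [← mul_assoc, zpow_mul, zpow_mul, zpow_natCast, zpow_natCast]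
    exact (congrArg (· ^ l) (H.pow j k)).trans (one_pow l)
  have hεE : ∀ j (l : ℕ), ε ^ (((dn / d j * m j : ℕ) : ℤ) * (d j * l)) = 1 := by
    intro j l
    rw [← mul_assoc, zpow_mul, zpow_mul, zpow_natCast, zpow_natCast, zpow_natCast]
    exact (congrArg (· ^ l) (H.prim j).pow_eq_one).trans (one_pow l)
  have hdn : ∀ j, ((dn / d j : ℕ) : T) * d j = dn := fun j => by
    rw [← Nat.cast_mul, Nat.div_mul_cancel (hdvd j _ (le_lastIdx j))]
  have hparE : ∀ j, parE (qUnit T) m d j = qUnit T ^ ((dn / d j * m j : ℕ) : ℤ) := fun j => by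
    rw [zpow_natCast]; rfl
  have hparB : ∀ j k, parB (qUnit T) d mm dd j k =
      qUnit T ^ (((dn / dd j k : ℕ) : ℤ) * mm j k) := fun _ _ => rfl
  have hε' : ((ε⁻¹ : Tˣ) : T) = ε' := rfl
  have hZX : ∀ j k, P.br (Zseq E d X Y j.succ) (X k) =
      (if k ≤ j then -(m k * d j * dn * ε' : T) else 0) • (Zseq E d X Y j.succ * X k) := by
    intro j k
    have hq := qCommute_zz_x (E := parE (qUnit T) m d) hqB j.succ k
    simp only [Fin.castSucc_lt_succ_iff] at hq
    split_ifs at hq ⊢ with h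
    · rw [hparE, ← zpow_neg] at hq
      rw [hP.br_pow_pow (hσZ j) (hσX k) hq
        (by rw [mul_comm (d j : ℤ), neg_mul, zpow_neg, hεE, inv_one])]
      congr 1
      simp only [Int.cast_mul, Int.cast_neg, Int.cast_natCast, Nat.cast_mul, hε']
      linear_combination (-(m k * d j * ε') : T) * hdn k
    · rw [← zpow_zero (qUnit T)] at hq
      rw [hP.br_pow_pow (hσZ j) (hσX k) hq (by simp)]
      simp
  have hZY : ∀ j k, P.br (Zseq E d X Y j.succ) (Y k) =
      (if k ≤ j then (m k * d j * dn * ε' : T) else 0) • (Zseq E d X Y j.succ * Y k) := by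
    intro j k
    have hq := qCommute_zz_y (E := parE (qUnit T) m d) hqB j.succ k
    simp only [Fin.castSucc_lt_succ_iff] at hq
    split_ifs at hq ⊢ with h
    · rw [hparE] at hq
      rw [hP.br_pow_pow (hσZ j) (hσY k) hq (by rw [mul_comm (d j : ℤ), hεE])]
      congr 1
      simp only [Int.cast_mul, Int.cast_natCast, Nat.cast_mul, hε']
      linear_combination (m k * d j * ε' : T) * hdn k
    · rw [← zpow_zero (qUnit T)] at hq
      rw [hP.br_pow_pow (hσZ j) (hσY k) hq (by simp)]
      simp
  refine ⟨hσ, X, Y, hX, hY, ?_, fun j => ⟨?_, ?_⟩, P, hP, fun j => ?_, fun j k => ?_,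
    fun j k h => ?_, fun j k h => ?_, fun j k h => ?_, hZX, hZY, fun j k => ?_⟩
  · rw [hXY]
    exact ⟨H.aeval_injective, H.aeval_surjective⟩
  · rw [z_eq_zz, z_eq_zz]
    exact congrArg (· ^ d j) (spec_zz _)
  · rw [z_eq_zz, H.coe_Zseq hX hY, Fin.cons_succ]
  -- The element `c` stands for `d_j d_n (1 - ε_j)^{-d_j}` and exists in `T` because `d_j ∣ d_n`.
  · obtain ⟨c, hc⟩ := H.exists_mul_eq (hdvd j _ (le_lastIdx j))
    refine ⟨c, hc, ?_⟩
    have := H.isDomain_center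
    have ht : (1 - (E j : T)) ^ d j ≠ 0 :=
      pow_ne_zero _ (sub_ne_zero.2 fun h => H.ne_one j (Units.ext h.symm))
    -- Here `t = (1 - ε_j)^{d_j}`, `r = m_j ε⁻¹` and `s = d_j d_n`. The inputs are that `z_{j-1}`
    -- commutes with `x_j` already over `T[q, q⁻¹]`, and the known bracket of `Z_j` with `X_j`.
    refine P.br_eq_of_cancel
      (fun a b h => Subtype.ext (H.smul_right_injective ht (congrArg Subtype.val h)))
      (H.centralGen_ne_zero _) (Zseq_succ X Y j) ?_ ?_ hc
    · have hq := qCommute_zz_x (E := parE (qUnit T) m d) hqB j.castSucc j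
      rw [if_neg (lt_irrefl _), ← zpow_zero (qUnit T)] at hq
      rw [hP.br_pow_pow (hσW j) (hσX j) hq (by simp)]
      simp
    · rw [hZX, if_pos le_rfl]
      congr 1
      ring
  · have hq : QCommute (parB (qUnit T) d mm dd j k) _ _ :=
      y_mul_y (parE (qUnit T) m d) (parB (qUnit T) d mm dd) j k
    rw [hparB] at hq
    rw [hP.br_pow_pow (hσY j) (hσY k) hq (hεB j k (d k))]
    congr 1
    simp only [Int.cast_mul, Int.cast_natCast, hε']
    ring
  · have hq : QCommute (parB (qUnit T) d mm dd k j) _ _ :=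
      x_mul_y_of_lt (parE (qUnit T) m d) (parB (qUnit T) d mm dd) h
    rw [hparB] at hq
    rw [hP.br_pow_pow (hσX j) (hσY k) hq (by rw [mul_comm (d j : ℤ)]; exact hεB k j (d j))]
    congr 1
    -- The relation carries `β_kj`, while the formula is written with `m_jk`; this is the source of
    -- the minus sign.
    rw [hdd_symm k j, hmm_skew k j]
    simp only [Int.cast_mul, Int.cast_neg, Int.cast_natCast, hε']
    ring
  · have hq : QCommute (parE (qUnit T) m d j * parB (qUnit T) d mm dd j k) _ _ :=
      x_mul_x (parE (qUnit T) m d) (parB (qUnit T) d mm dd) h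
    rw [hparE, hparB, ← zpow_add] at hq
    rw [hP.br_pow_pow (hσX j) (hσX k) hq (by
      rw [add_mul, zpow_add, hεE, one_mul]
      exact hεB j k (d k))]
    congr 1
    simp only [Int.cast_mul, Int.cast_add, Int.cast_natCast, Nat.cast_mul, hε']
    ring
  · have hq : QCommute (parE (qUnit T) m d k * parB (qUnit T) d mm dd k j) _ _ :=
      x_mul_y_of_gt (parE (qUnit T) m d) (parB (qUnit T) d mm dd) h
    rw [hparE, hparB, ← zpow_add] at hq
    rw [hP.br_pow_pow (hσX j) (hσY k) hq (by
      rw [mul_comm (d j : ℤ), add_mul, zpow_add, hεE, one_mul]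
      exact hεB k j (d j))]
    congr 1
    simp only [Int.cast_mul, Int.cast_add, Int.cast_natCast, Nat.cast_mul, hε']
    ring
  · have hq := qCommute_one_iff (R := LaurentPolynomial T).2
      (commute_zz_zz (E := parE (qUnit T) m d) hqB j.succ k.succ)
    rw [← zpow_zero (qUnit T)] at hq
    rw [hP.br_pow_pow (hσZ j) (hσZ k) hq (by simp)]
    simp
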